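/- All manifolds are smooth, finite dimensional, Hausdorff, second countable and without boundary. A discrete tangent bundle of a manifold $Q$ is a manifold $V$ with $\dim V=2\dim Q$ and two submersions $\partial^+,\partial^-:V\to Q$ such that $\ker T\partial^+\cap\ker T\partial^-=0$ and such that for each $q\in Q$ there is exactly one $v\in V$ with $\partial^+(v)=\partial^-(v)=q$. Every $\delta v\in T_vV$ then splits uniquely as $\delta v=\delta v^++\delta v^-$ with $\delta v^+\in\ker T_v\partial^-$ and $\delta v^-\in\ker T_v\partial^+$. A discrete constrained Lagrangian system (DCLS) consists of a discrete tangent bundle $(V,\partial^+,\partial^-)$ of $Q$, a smooth one-form $\sigma_d$ on $V$, an embedded submanifold $\mathcal D_d\subseteq V$ such that $\partial^+|_{\mathcal D_d}$ and $\partial^-|_{\mathcal D_d}$ are submersions, and a smooth subbundle $\mathcal E_d$ of the pullback bundle $(\partial^+|_{\mathcal D_d})^*TQ$. A pair $(v,\tilde v)$ is a solution pair if $v,\tilde v\in\mathcal D_d$, $\partial^+(v)=\partial^-(\tilde v)$, and $\sigma_d(v)\,\delta v+\sigma_d(\tilde v)\,\delta\tilde v=0$ for all $\delta v\in T_vV$,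 $\delta\tilde v\in T_{\tilde v}V$ with $T\partial^-(\delta v)=0$, $T\partial^+(\delta\tilde v)=0$ and $T\partial^+(\delta v)=T\partial^-(\delta\tilde v)\in(\mathcal E_d)_v$. An evolution of the DCLS is a map $F:U_F\to V_F$ between subsets of $V$ such that $(v,F(v))$ is a solution pair for every $v\in U_F\cap\mathcal D_d$. The DCLS is holonomic, with distribution $\mathcal D_d^Q$, if $\mathcal D_d^Q\subseteq TQ$ is a smooth involutive distribution of constant rank $r$ such that $(\mathcal E_d)_v=(\mathcal D_d^Q)_{\partial^+(v)}$ for all $v\in\mathcal D_d$; for all $v\in\mathcal D_d$ the points $\partial^-(v)$ and $\partial^+(v)$ are joined by a piecewise smooth curve tangent to $\mathcal D_d^Q$; $\dim\mathcal D_d=\dim Q+r$; and $d\sigma_d=0$. If a Lie group $G$ with Lie algebra $\mathfrak g$ acts smoothly on a manifold $M$, write $\xi m=\frac{d}{dt}\big|_{t=0}\exp(t\xi)m$ for $\xi\in\mathfrak g$, $m\in M$. A DCLS with smooth actions of $G$ on $Q$ and $V$ is symmetric if $\partial^\pm$ are equivariant, if $\sigma_d$, $\mathcal D_d$ and $\mathcal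 E_d$ are $G$-invariant, and if $\sigma_d(v)(\xi v)=0$ for all $\xi\in\mathfrak g$, $v\in\mathcal D_d$. The momentum maps $J^\pm:V\to\mathfrak g^*$ are $\langle J^+(v),\xi\rangle=\sigma_d(v)\big((\xi v)^+\big)$ and $\langle J^-(v),\xi\rangle=-\sigma_d(v)\big((\xi v)^-\big)$. **Corollary.** Let $F:U_F\to V_F$ be an evolution of a holonomic DCLS, and let a Lie group $G$ act smoothly on $V$ and on $Q$ such that 1. $\partial^+$ and $\partial^-$ are equivariant; 2. $\mathcal D_d^Q$ is $G$-invariant; 3. $\xi q\in(\mathcal D_d^Q)_q$ for all $\xi\in\mathfrak g$, $q\in Q$; 4. $\sigma_d$ is $G$-invariant and $\sigma_d(v)(\xi v)=0$ for all $\xi\in\mathfrak g$, $v\in\mathcal D_d$. Then * (a) $\xi v\in T_v\mathcal D_d$ for all $\xi\in\mathfrak g$, $v\in\mathcal D_d$, and for every $v\in\mathcal D_d$ one has $gv\in\mathcal D_d$ for all $g$ in a neighbourhood of the identity of $G$; moreover $\mathcal E_d$ is invariant: $g(\mathcal E_d)_v=(\mathcal E_d)_{gv}$ whenever $v,gv\in\mathcal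 D_d$; * (b) if $G$ is connected and $\mathcal D_d$ is closed in $V$, then $\mathcal D_d$ is $G$-invariant and the DCLS is symmetric; * (c) $F$ conserves momentum: for all $v\in U_F\cap\mathcal D_d$ one has $J^+(v)=J^-(v)$, $J^+(F(v))=J^-(F(v))$ and $J^+(F(v))=J^+(v)$. -/

import Mathlib

open scoped Manifold ContDiff Topology
open Set Module

noncomputable section

namespace DiscreteMechanics

section Differential

variable {E : Type*} [NormedAddCommGroup E] [NormedSpace ℝ E]
  {M : Type*} [TopologicalSpace M] [ChartedSpace E M]
  {E' : Type*} [NormedAddCommGroup E'] [NormedSpace ℝ E']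
  {N : Type*} [TopologicalSpace N] [ChartedSpace E' N]

variable (E E') in
/-- The tangent map `T_x f : T_x M → T_{f x} N`. -/
abbrev dmap (f : M → N) (x : M) :
    TangentSpace 𝓘(ℝ, E) x →L[ℝ] TangentSpace 𝓘(ℝ, E') (f x) :=
  mfderiv 𝓘(ℝ, E) 𝓘(ℝ, E') f x

variable (E E') in
/-- A smooth map all of whose tangent maps are onto. -/
structure IsSubmersive (f : M → N) : Prop where
  smooth : ContMDiff 𝓘(ℝ, E) 𝓘(ℝ, E') ∞ f
  surjective : ∀ x, Function.Surjective (dmap E E' f x)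

variable (E E') in
/-- A smooth embedding: a smooth topological embedding with injective tangent maps.  Its range is
an (embedded) submanifold of `N` with tangent spaces `range (T_x f)`. -/
structure IsSmoothEmb (f : M → N) : Prop where
  smooth : ContMDiff 𝓘(ℝ, E) 𝓘(ℝ, E') ∞ f
  injective : ∀ x, Function.Injective (dmap E E' f x)
  isEmbedding : Topology.IsEmbedding f

variable (E) in
/-- `Ξ` is a smooth rank `r` subbundle of the pullback bundle `f^* TN`: locally it is
spanned by `r` smooth sections of `TN` along `f`, and all fibres have dimension `r`. -/
def IsSubbundleAlong [IsManifold 𝓘(ℝ, E') ∞ N] (f : M → N) (Ξ : ∀ x : M, Submodule ℝ (TangentSpace 𝓘(ℝ, E') (f x)))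
    (r : ℕ) : Prop :=
  (∀ x, finrank ℝ (Ξ x) = r) ∧
  ∀ x₀ : M, ∃ U : Set M, IsOpen U ∧ x₀ ∈ U ∧
    ∃ s : Fin r → ∀ x : M, TangentSpace 𝓘(ℝ, E') (f x),
      (∀ i, ContMDiffOn 𝓘(ℝ, E) 𝓘(ℝ, E').tangent ∞
        (fun x => (⟨f x, s i x⟩ : TangentBundle 𝓘(ℝ, E') N)) U) ∧
      ∀ x ∈ U, Ξ x = Submodule.span ℝ (range fun i => s i x)

/-! ### Distributions -/

/-- A smooth distribution of constant rank `r`, i.e. a rank `r` subbundle of `TM`. -/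
def IsDistribution [IsManifold 𝓘(ℝ, E) ∞ M] (Δ : ∀ x : M, Submodule ℝ (TangentSpace 𝓘(ℝ, E) x)) (r : ℕ) : Prop :=
  IsSubbundleAlong E (id : M → M) Δ r

/-- `Δ` is involutive: the Lie bracket of two local smooth vector fields with values in `Δ` has
values in `Δ`. -/
def IsInvolutive [IsManifold 𝓘(ℝ, E) ∞ M] (Δ : ∀ x : M, Submodule ℝ (TangentSpace 𝓘(ℝ, E) x)) : Prop :=
  ∀ U : Set M, IsOpen U → ∀ X Y : ∀ x : M, TangentSpace 𝓘(ℝ, E) x,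
    ContMDiffOn 𝓘(ℝ, E) 𝓘(ℝ, E).tangent ∞ (fun x => (⟨x, X x⟩ : TangentBundle 𝓘(ℝ, E) M)) U →
    ContMDiffOn 𝓘(ℝ, E) 𝓘(ℝ, E).tangent ∞ (fun x => (⟨x, Y x⟩ : TangentBundle 𝓘(ℝ, E) M)) U →
    (∀ x ∈ U, X x ∈ Δ x) → (∀ x ∈ U, Y x ∈ Δ x) →
    ∀ x ∈ U, VectorField.mlieBracket 𝓘(ℝ, E) X Y x ∈ Δ x

/-- `x` and `y` are joined by a smooth curve on a compact interval, tangent to `Δ`. -/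
def IsJoinedBySmooth (Δ : ∀ x : M, Submodule ℝ (TangentSpace 𝓘(ℝ, E) x)) (x y : M) : Prop :=
  ∃ (a b : ℝ) (c : ℝ → M), a < b ∧ ContMDiffOn 𝓘(ℝ, ℝ) 𝓘(ℝ, E) ∞ c (Icc a b) ∧
    (∀ t ∈ Icc a b, mfderivWithin 𝓘(ℝ, ℝ) 𝓘(ℝ, E) c (Icc a b) t (1 : ℝ) ∈ Δ (c t)) ∧
    c a = x ∧ c b = y

/-- `y` is `Δ`-reachable from `x`: the two are joined by a piecewise smooth curve tangent to `Δ`,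
i.e. by a finite concatenation of smooth ones. -/
def IsReachable (Δ : ∀ x : M, Submodule ℝ (TangentSpace 𝓘(ℝ, E) x)) : M → M → Prop :=
  Relation.ReflTransGen (IsJoinedBySmooth Δ)

/-! ### One-forms -/

/-- The expression of a one-form in the preferred chart at `x₀`. -/
def formInChart (σ : ∀ x : M, TangentSpace 𝓘(ℝ, E) x →L[ℝ] ℝ) (x₀ : M) (y : E) : E →L[ℝ] ℝ :=
  (σ ((extChartAt 𝓘(ℝ, E) x₀).symm y)).comp (dmap E E (extChartAt 𝓘(ℝ, E) x₀).symm y)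

/-- Smoothness of a one-form. -/
def IsSmoothForm (σ : ∀ x : M, TangentSpace 𝓘(ℝ, E) x →L[ℝ] ℝ) : Prop :=
  ∀ x₀ : M, ContDiffOn ℝ ∞ (formInChart σ x₀) (extChartAt 𝓘(ℝ, E) x₀).target

/-- `dσ = 0` for a smooth one-form: in charts, `dσ(a, b) = (D_a σ)(b) - (D_b σ)(a)`. -/
def IsClosedForm (σ : ∀ x : M, TangentSpace 𝓘(ℝ, E) x →L[ℝ] ℝ) : Prop :=
  ∀ x₀ : M, ∀ y ∈ (extChartAt 𝓘(ℝ, E) x₀).target, ∀ a b : E,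
    fderiv ℝ (formInChart σ x₀) y a b - fderiv ℝ (formInChart σ x₀) y b a = 0

end Differential

section Action

variable {EG : Type*} [NormedAddCommGroup EG] [NormedSpace ℝ EG]
  (G : Type*) [TopologicalSpace G] [ChartedSpace EG G] [Group G]
  {E : Type*} [NormedAddCommGroup E] [NormedSpace ℝ E]
  {M : Type*} [TopologicalSpace M] [ChartedSpace E M] [MulAction G M]

/-- The infinitesimal generator `ξ ↦ ξ m`: the derivative at the identity of `g ↦ g • m`. -/
def infGen (m : M) : GroupLieAlgebra 𝓘(ℝ, EG) G →L[ℝ] TangentSpace 𝓘(ℝ, E) m :=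
  (mfderiv 𝓘(ℝ, EG) 𝓘(ℝ, E) (fun g : G => g • m) 1 : EG →L[ℝ] E)

/-- `G`-invariance of a distribution. -/
def IsInvariantDistribution (Δ : ∀ x : M, Submodule ℝ (TangentSpace 𝓘(ℝ, E) x)) : Prop :=
  ∀ (g : G) (x : M), (Δ x).map (dmap E E (fun y : M => g • y) x).toLinearMap = Δ (g • x)

/-- `G`-invariance of a one-form. -/
def IsInvariantForm (σ : ∀ x : M, TangentSpace 𝓘(ℝ, E) x →L[ℝ] ℝ) : Prop :=
  ∀ (g : G) (x : M) (w : TangentSpace 𝓘(ℝ, E) x),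
    σ (g • x) (dmap E E (fun y : M => g • y) x w) = σ x w

end Action

/-! ### Discrete tangent bundles and discrete constrained Lagrangian systems -/

section Systems

variable (EQ : Type*) [NormedAddCommGroup EQ] [NormedSpace ℝ EQ] [FiniteDimensional ℝ EQ]
  (Q : Type*) [TopologicalSpace Q] [ChartedSpace EQ Q] [IsManifold 𝓘(ℝ, EQ) ∞ Q]
  (EV : Type*) [NormedAddCommGroup EV] [NormedSpace ℝ EV] [FiniteDimensional ℝ EV]
  (V : Type*) [TopologicalSpace V] [ChartedSpace EV V]
  (ED : Type*) [NormedAddCommGroup ED] [NormedSpace ℝ ED] [FiniteDimensional ℝ ED]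
  (D : Type*) [TopologicalSpace D] [ChartedSpace ED D]

/-- A discrete tangent bundle `(V, ∂⁺, ∂⁻)` of `Q`. -/
structure DiscreteTangentBundle where
  plus : V → Q
  minus : V → Q
  dim_eq : finrank ℝ EV = 2 * finrank ℝ EQ
  plus_submersive : IsSubmersive EV EQ plus
  minus_submersive : IsSubmersive EV EQ minus
  ker_inf_ker : ∀ v, (dmap EV EQ plus v).ker ⊓
    (dmap EV EQ minus v).ker = ⊥
  existsUnique_zero : ∀ q : Q, ∃! v : V, plus v = q ∧ minus v = q

/-- A discrete constrained Lagrangian system `(V, ∂⁺, ∂⁻, σ, 𝒟, ℰ)`.  The velocity constraint `𝒟`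
is the submanifold of `V` that is the range of the smooth embedding `incl : D → V`. -/
structure DCLS extends DiscreteTangentBundle EQ Q EV V where
  σ : ∀ v : V, TangentSpace 𝓘(ℝ, EV) v →L[ℝ] ℝ
  σ_smooth : IsSmoothForm σ
  incl : D → V
  incl_emb : IsSmoothEmb ED EV incl
  plus_incl_submersive : IsSubmersive ED EQ (plus ∘ incl)
  minus_incl_submersive : IsSubmersive ED EQ (minus ∘ incl)
  force : ∀ d : D, Submodule ℝ (TangentSpace 𝓘(ℝ, EQ) (plus (incl d)))
  force_subbundle : ∃ k, IsSubbundleAlong ED (plus ∘ incl) force k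

variable {EQ Q EV V ED D}

namespace DiscreteTangentBundle

/-- The forward vertical space `ker T_v ∂⁻`. -/
def vertMinus (B : DiscreteTangentBundle EQ Q EV V) (v : V) :
    Submodule ℝ (TangentSpace 𝓘(ℝ, EV) v) :=
  (dmap EV EQ B.minus v).ker

/-- The backward vertical space `ker T_v ∂⁺`. -/
def vertPlus (B : DiscreteTangentBundle EQ Q EV V) (v : V) :
    Submodule ℝ (TangentSpace 𝓘(ℝ, EV) v) :=
  (dmap EV EQ B.plus v).ker

theorem isCompl_vert (B : DiscreteTangentBundle EQ Q EV V) (v : V) :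
    IsCompl (B.vertMinus v) (B.vertPlus v) := by
  have : FiniteDimensional ℝ (TangentSpace 𝓘(ℝ, EV) v) := inferInstanceAs (FiniteDimensional ℝ EV)
  have e1 := LinearMap.finrank_range_add_finrank_ker (dmap EV EQ B.minus v).toLinearMap
  have e2 := LinearMap.finrank_range_add_finrank_ker (dmap EV EQ B.plus v).toLinearMap
  rw [LinearMap.range_eq_top.2 (B.minus_submersive.surjective v), finrank_top] at e1
  rw [LinearMap.range_eq_top.2 (B.plus_submersive.surjective v), finrank_top] at e2
  have hd := B.dim_eq
  have h0 : Disjoint (B.vertMinus v) (B.vertPlus v) := by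
    rw [disjoint_iff, inf_comm]; exact B.ker_inf_ker v
  refine ⟨h0, codisjoint_iff.2 (Submodule.eq_top_of_disjoint _ _ ?_ h0)⟩
  change finrank ℝ EQ + finrank ℝ (B.vertMinus v) = finrank ℝ EV at e1
  change finrank ℝ EQ + finrank ℝ (B.vertPlus v) = finrank ℝ EV at e2
  change finrank ℝ EV ≤ _
  omega

/-- `δv ↦ δv⁺`, where `δv = δv⁺ + δv⁻`, `δv⁺ ∈ ker T∂⁻`, `δv⁻ ∈ ker T∂⁺`. -/
def plusPart (B : DiscreteTangentBundle EQ Q EV V) (v : V) :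
    TangentSpace 𝓘(ℝ, EV) v →ₗ[ℝ] TangentSpace 𝓘(ℝ, EV) v :=
  (B.vertMinus v).projection (B.vertPlus v) (B.isCompl_vert v)

/-- `δv ↦ δv⁻`, where `δv = δv⁺ + δv⁻`, `δv⁺ ∈ ker T∂⁻`, `δv⁻ ∈ ker T∂⁺`. -/
def minusPart (B : DiscreteTangentBundle EQ Q EV V) (v : V) :
    TangentSpace 𝓘(ℝ, EV) v →ₗ[ℝ] TangentSpace 𝓘(ℝ, EV) v :=
  (B.vertPlus v).projection (B.vertMinus v) (B.isCompl_vert v).symm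

end DiscreteTangentBundle

namespace DCLS

variable (S : DCLS EQ Q EV V ED D)

/-- The velocity constraint, as a subset of `V`. -/
def constraint : Set V := range S.incl

/-- The tangent space of the velocity constraint at one of its points. -/
def tangentConstraint (d : D) : Submodule ℝ (TangentSpace 𝓘(ℝ, EV) (S.incl d)) :=
  (dmap ED EV S.incl d).range

/-- `(v, v')` with `v = incl d`, `v' = incl d'` is a solution pair, i.e. it satisfies the discrete
Lagrange-d'Alembert principle for sequences of length two: it is first order, and
`σ(v) δv + σ(v') δv' = 0` for all variations with fixed boundary that are first order and
have `T∂⁺ δv` in the constraint force bundle. -/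
def IsSolutionPair (d d' : D) : Prop :=
  S.plus (S.incl d) = S.minus (S.incl d') ∧
  ∀ (w : TangentSpace 𝓘(ℝ, EV) (S.incl d)) (w' : TangentSpace 𝓘(ℝ, EV) (S.incl d')),
    dmap EV EQ S.minus (S.incl d) w = 0 →
    dmap EV EQ S.plus (S.incl d') w' = 0 →
    (dmap EV EQ S.plus (S.incl d) w : EQ) = (dmap EV EQ S.minus (S.incl d') w' : EQ) →
    dmap EV EQ S.plus (S.incl d) w ∈ S.force d →
    S.σ (S.incl d) w + S.σ (S.incl d') w' = 0

/-- `F : U → W` is an evolution map: `(v, F v)` is a solution pair for every `v ∈ U` in the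
velocity constraint.  (In particular `F v` is again in the velocity constraint.) -/
structure IsEvolution (F : V → V) (U W : Set V) : Prop where
  mapsTo : MapsTo F U W
  solution : ∀ d : D, S.incl d ∈ U → ∃ d' : D, S.incl d' = F (S.incl d) ∧ S.IsSolutionPair d d'

/-- The system has linear constraints, with constraint distribution `Δ` on `Q`. -/
structure HasLinearConstraints (Δ : ∀ q : Q, Submodule ℝ (TangentSpace 𝓘(ℝ, EQ) q)) : Prop where
  force_eq : ∀ d, S.force d = Δ (S.plus (S.incl d))
  reachable : ∀ d, IsReachable Δ (S.minus (S.incl d)) (S.plus (S.incl d))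
  /-- `dim 𝒟` is the dimension `dim Q + r` of the total space of the rank `r` bundle `Δ`. -/
  distribution_dim : ∃ r, IsDistribution Δ r ∧ finrank ℝ ED = finrank ℝ EQ + r

/-- The system is holonomic, with constraint distribution `Δ` on `Q`. -/
structure IsHolonomic (Δ : ∀ q : Q, Submodule ℝ (TangentSpace 𝓘(ℝ, EQ) q)) : Prop
    extends S.HasLinearConstraints Δ where
  involutive : IsInvolutive Δ
  closed : IsClosedForm S.σ

section Momentum

variable {EG : Type*} [NormedAddCommGroup EG] [NormedSpace ℝ EG]
  (G : Type*) [TopologicalSpace G] [ChartedSpace EG G] [Group G]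
  [MulAction G Q] [MulAction G V]

/-- `G`-invariance of the constraint force bundle: `g ℰ_v = ℰ_{g v}` whenever `v` and `g v` are in
the velocity constraint. -/
def IsInvariantForce : Prop :=
  ∀ (g : G) (d d' : D), S.incl d' = g • S.incl d →
    (S.force d).map (dmap EQ EQ (fun q : Q => g • q) (S.plus (S.incl d)) : EQ →L[ℝ] EQ).toLinearMap
      = S.force d'

/-- The given actions of `G` on `Q` and on `V` form an action on the system, i.e. the system is
symmetric. -/
structure IsSymmetric : Prop where
  plus_smul : ∀ (g : G) (v : V), S.plus (g • v) = g • S.plus v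
  minus_smul : ∀ (g : G) (v : V), S.minus (g • v) = g • S.minus v
  form_invariant : IsInvariantForm G S.σ
  constraint_invariant : ∀ (g : G), ∀ v ∈ S.constraint, g • v ∈ S.constraint
  force_invariant : S.IsInvariantForce G
  form_infGen : ∀ v ∈ S.constraint, ∀ ξ : GroupLieAlgebra 𝓘(ℝ, EG) G, S.σ v (infGen G v ξ) = 0

/-- The momentum map `J⁺_ξ(v) = σ(v)((ξ v)⁺)`. -/
def momentumPlus (v : V) : Dual ℝ (GroupLieAlgebra 𝓘(ℝ, EG) G) :=
  (S.σ v).toLinearMap ∘ₗ S.plusPart v ∘ₗ (infGen G v).toLinearMap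

/-- The momentum map `J⁻_ξ(v) = -σ(v)((ξ v)⁻)`. -/
def momentumMinus (v : V) : Dual ℝ (GroupLieAlgebra 𝓘(ℝ, EG) G) :=
  -((S.σ v).toLinearMap ∘ₗ S.minusPart v ∘ₗ (infGen G v).toLinearMap)

/-- `F` conserves momentum on `U`: on the part of the velocity constraint in `U`, the two momentum
maps agree, they agree at the image points, and their value is preserved by `F`. -/
def ConservesMomentum (F : V → V) (U : Set V) : Prop :=
  ∀ v ∈ U ∩ S.constraint,
    S.momentumPlus (EG := EG) G v = S.momentumMinus G v ∧
    S.momentumPlus (EG := EG) G (F v) = S.momentumMinus G (F v) ∧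
    S.momentumPlus (EG := EG) G (F v) = S.momentumPlus G v

end Momentum

end DCLS

end Systems

end DiscreteMechanics

end

/-!
By the Frobenius theorem, `Δ` is locally the kernel of the derivative of a submersion to a vector
space, and countably many such flow boxes cover `Q`. A leaf meets the transversal of each flow box
in a countable set. Since `∂⁻` and `∂⁺` of a point of the velocity constraint lie on one leaf, the
transverse coordinate of `∂⁺` takes only countably many values along a level set of the transverse
coordinate of `∂⁻`; as it is continuous and the level set is connected, it is constant. This makes
the tangent map of `𝒟` respect `Δ`, and by the dimension of `𝒟` every vector of `V` with both
endpoint velocities in `Δ` is tangent to `𝒟`. The inverse function theorem then shows that `𝒟`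
contains, near each of its points, all points of `V` with the same transverse coordinates. Orbits
tangent to `Δ` keep these coordinates, so small group elements preserve `𝒟`. Momentum conservation
is the Lagrange-d'Alembert principle tested on the two parts of the generators.
-/

noncomputable section

namespace DiscreteMechanics

section Superposition

variable {X : Type*} [TopologicalSpace X] [CompactSpace X]
  {E : Type*} [NormedAddCommGroup E] [NormedSpace ℝ E]
  {F : Type*} [NormedAddCommGroup F] [NormedSpace ℝ F]

/-- Bounded bilinear maps between normed spaces.  On spaces `C(X, E)` this selects the topology of
the norm instead of the compact-open topology, to which it is equal but not reducibly so. -/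
abbrev BoundedBilinear (E₁ E₂ E₃ : Type*) [NormedAddCommGroup E₁] [NormedSpace ℝ E₁]
    [NormedAddCommGroup E₂] [NormedSpace ℝ E₂] [NormedAddCommGroup E₃] [NormedSpace ℝ E₃] :=
  E₁ →L[ℝ] E₂ →L[ℝ] E₃

variable (X E F) in
/-- Pointwise application of a continuous family of operators to a continuous function, as a
bounded bilinear map.  Derivatives of superposition operators `y ↦ f ∘ y` are of this form. -/
def pointwiseEval : BoundedBilinear C(X, E →L[ℝ] F) C(X, E) C(X, F) :=
  LinearMap.mkContinuous₂
    (LinearMap.mk₂ ℝ (fun (L : C(X, E →L[ℝ] F)) (y : C(X, E)) =>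
        (⟨fun s => L s (y s), by fun_prop⟩ : C(X, F)))
      (fun _ _ _ => by ext; simp) (fun _ _ _ => by ext; simp)
      (fun _ _ _ => by ext; simp) (fun _ _ _ => by ext; simp)) 1
    (fun L y => by
      rw [one_mul, ContinuousMap.norm_le _ (by positivity)]
      intro s
      exact (L s).le_of_opNorm_le_of_le (L.norm_coe_le_norm s) (y.norm_coe_le_norm s))

@[simp] theorem pointwiseEval_apply (L : C(X, E →L[ℝ] F)) (y : C(X, E)) (s : X) :
    pointwiseEval X E F L y s = L s (y s) := rfl

theorem hasFDerivAt_superposition {f : C(E, F)} {f' : C(E, E →L[ℝ] F)}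
    (hf : ∀ x, HasFDerivAt f (f' x) x) (y : C(X, E)) :
    HasFDerivAt (fun y : C(X, E) => f.comp y) (pointwiseEval X E F (f'.comp y)) y := by
  rw [hasFDerivAt_iff_isLittleO_nhds_zero, Asymptotics.isLittleO_iff]
  intro ε hε
  have hcont : ∀ᶠ z in 𝓝 y, dist (f'.comp z) (f'.comp y) < ε :=
    f'.continuous_postcomp.continuousAt.eventually (Metric.ball_mem_nhds (f'.comp y) hε)
  obtain ⟨δ, hδ, H⟩ := Metric.eventually_nhds_iff.1 hcont
  filter_upwards [Metric.ball_mem_nhds (0 : C(X, E)) hδ] with h hh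
  rw [mem_ball_zero_iff] at hh
  rw [ContinuousMap.norm_le _ (by positivity)]
  intro s
  have hs : ‖h s‖ ≤ ‖h‖ := h.norm_coe_le_norm s
  have hball : ∀ z ∈ Metric.ball (y s) δ, ‖f' z - f' (y s)‖ ≤ ε := by
    intro z hz
    have hdist : dist (y + ContinuousMap.const X (z - y s)) y < δ := by
      rw [dist_eq_norm, add_sub_cancel_left]
      refine lt_of_le_of_lt ?_ (mem_ball_iff_norm.1 hz)
      exact (ContinuousMap.norm_le _ (norm_nonneg _)).2 fun _ => le_rfl
    simpa [dist_eq_norm] using (ContinuousMap.dist_apply_le_dist s).trans (H hdist).le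
  have hmean : ‖f (y s + h s) - f (y s) - f' (y s) (y s + h s - y s)‖ ≤ ε * ‖y s + h s - y s‖ :=
    (convex_ball (y s) δ).norm_image_sub_le_of_norm_hasFDerivWithin_le'
      (fun z _ => (hf z).hasFDerivWithinAt) hball (Metric.mem_ball_self hδ)
      (by simpa using hs.trans_lt hh)
  rw [add_sub_cancel_left] at hmean
  exact hmean.trans (by gcongr)

theorem contDiff_superposition {f : C(E, F)} {f' : C(E, E →L[ℝ] F)}
    (hf : ∀ x, HasFDerivAt f (f' x) x) : ContDiff ℝ 1 fun y : C(X, E) => f.comp y :=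
  contDiff_one_iff_hasFDerivAt.2 ⟨_, (pointwiseEval X E F).continuous.comp f'.continuous_postcomp,
    hasFDerivAt_superposition hf⟩

end Superposition

section Primitive

variable {E : Type*} [NormedAddCommGroup E] [NormedSpace ℝ E]

variable (E) in
/-- The primitive vanishing at `0` of a continuous function on the unit interval, as a bounded
operator; the integrand is extended to the real line by constants. -/
def primitive : C(unitInterval, E) →L[ℝ] C(unitInterval, E) :=
  LinearMap.mkContinuous
    { toFun := fun y => ⟨fun t => ∫ s in (0 : ℝ)..t, IccExtend zero_le_one y s, by
        have := intervalIntegral.continuous_primitive (μ := MeasureTheory.volume)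
          (fun a b => (y.continuous.Icc_extend' (h := zero_le_one)).intervalIntegrable a b) 0
        fun_prop⟩
      map_add' := fun y z => by
        ext t
        exact intervalIntegral.integral_add
          (y.continuous.Icc_extend'.intervalIntegrable _ _)
          (z.continuous.Icc_extend'.intervalIntegrable _ _)
      map_smul' := fun c y => by
        ext t
        exact intervalIntegral.integral_smul c _ } 1
    (fun y => by
      rw [one_mul, ContinuousMap.norm_le _ (by positivity)]
      intro t
      have := intervalIntegral.norm_integral_le_of_norm_le_const (a := 0) (b := (t : ℝ))
        (C := ‖y‖) (f := IccExtend zero_le_one y)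
        (fun s _ => y.norm_coe_le_norm _)
      refine this.trans (mul_le_of_le_one_right (by positivity) ?_)
      rw [sub_zero, abs_of_nonneg t.2.1]
      exact t.2.2)

theorem primitive_apply (y : C(unitInterval, E)) (t : unitInterval) :
    primitive E y t = ∫ s in (0 : ℝ)..t, IccExtend zero_le_one y s := rfl

variable [CompleteSpace E]

theorem eq_primitive_of_hasDerivAt {g w : C(unitInterval, E)} {y : ℝ → E}
    (hy : ∀ t : unitInterval, HasDerivAt y (g t) t) (h0 : y 0 = 0)
    (hw : ∀ t : unitInterval, w t = y t) : w = primitive E g := by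
  ext t
  have hderiv : ∀ s ∈ uIcc (0 : ℝ) t, HasDerivAt y (IccExtend zero_le_one g s) s := by
    intro s hs
    rw [uIcc_of_le t.2.1] at hs
    have hs' : s ∈ Icc (0 : ℝ) 1 := ⟨hs.1, hs.2.trans t.2.2⟩
    rw [IccExtend_of_mem _ _ hs']
    exact hy ⟨s, hs'⟩
  rw [primitive_apply, intervalIntegral.integral_eq_sub_of_hasDerivAt hderiv
    (g.continuous.Icc_extend'.intervalIntegrable _ _), h0, sub_zero, hw]

theorem exists_hasDerivAt_of_eq_add_primitive {g Y : C(unitInterval, E)} {b : E}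
    (hY : ∀ t, Y t = b + primitive E g t) :
    ∃ y : ℝ → E, (∀ t : unitInterval, HasDerivAt y (g t) t) ∧ ∀ t : unitInterval, y t = Y t := by
  have hg : Continuous (IccExtend zero_le_one g) := g.continuous.Icc_extend'
  refine ⟨fun t => b + ∫ s in (0 : ℝ)..t, IccExtend zero_le_one g s, fun t => ?_,
    fun t => (hY t).symm⟩
  have := (intervalIntegral.integral_hasDerivAt_right (hg.intervalIntegrable 0 t)
    (hg.stronglyMeasurableAtFilter _ _) hg.continuousAt).const_add b
  rwa [IccExtend_val] at this

end Primitive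

section JointFlow

variable {A : Type*} [NormedAddCommGroup A] [NormedSpace ℝ A]
  {E : Type*} [NormedAddCommGroup E] [NormedSpace ℝ E]
  {T : C(E, A →L[ℝ] E)} {T' : C(E, E →L[ℝ] A →L[ℝ] E)}

variable (T) in
/-- The defect of a curve `Y` on the unit interval from being the integral curve of the vector field
`x ↦ T x a` that starts at `b`, as a function of `((a, b), Y)`.  Integral curves are its zeros. -/
def flowDefect (p : (A × E) × C(unitInterval, E)) : C(unitInterval, E) :=
  p.2 - .const _ p.1.2 -
    primitive E (pointwiseEval _ A E (T.comp p.2) (.const _ p.1.1))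

variable (T T') in
/-- The derivative of `flowDefect T`, where `T'` stands for the derivative of `T`. -/
def flowDefectDeriv (p : (A × E) × C(unitInterval, E)) :
    (A × E) × C(unitInterval, E) →L[ℝ] C(unitInterval, E) :=
  .snd ℝ _ _ - .const ℝ unitInterval ∘L .snd ℝ _ _ ∘L .fst ℝ _ _ -
    primitive E ∘L
      (pointwiseEval _ A E (T.comp p.2) ∘L .const ℝ unitInterval ∘L .fst ℝ _ _ ∘L .fst ℝ _ _ +
        (pointwiseEval _ A E).flip (.const _ p.1.1) ∘L
          pointwiseEval _ E (A →L[ℝ] E) (T'.comp p.2) ∘L .snd ℝ _ _)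

theorem flowDefectDeriv_apply (p : (A × E) × C(unitInterval, E)) (u : A) (v : E)
    (h : C(unitInterval, E)) :
    flowDefectDeriv T T' p ((u, v), h) = h - .const _ v - primitive E
      (pointwiseEval _ A E (T.comp p.2) (.const _ u) +
        pointwiseEval _ A E (pointwiseEval _ E (A →L[ℝ] E) (T'.comp p.2) h)
          (.const _ p.1.1)) := rfl

theorem flowDefect_const (b : E) :
    flowDefect T ((0, b), .const _ b) = 0 := by
  simp [flowDefect]

theorem hasFDerivAt_flowDefect (hT : ∀ x, HasFDerivAt T (T' x) x)
    (p : (A × E) × C(unitInterval, E)) :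
    HasFDerivAt (flowDefect T) (flowDefectDeriv T T' p) p := by
  have hT_comp : HasFDerivAt (fun p : (A × E) × C(unitInterval, E) => T.comp p.2) _ p :=
    (hasFDerivAt_superposition hT p.2).comp p hasFDerivAt_snd
  have heval : HasFDerivAt (fun p : (A × E) × C(unitInterval, E) =>
      pointwiseEval unitInterval A E (T.comp p.2)) _ p :=
    (pointwiseEval unitInterval A E).hasFDerivAt.comp p hT_comp
  have hdirection : HasFDerivAt (fun p : (A × E) × C(unitInterval, E) =>
      ContinuousMap.const unitInterval p.1.1) _ p :=
    (ContinuousLinearMap.const (M := A) ℝ unitInterval).hasFDerivAt.comp p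
      (hasFDerivAt_fst.comp p hasFDerivAt_fst)
  have hstart : HasFDerivAt (fun p : (A × E) × C(unitInterval, E) =>
      ContinuousMap.const unitInterval p.1.2) _ p :=
    (ContinuousLinearMap.const (M := E) ℝ unitInterval).hasFDerivAt.comp p
      (hasFDerivAt_snd.comp p hasFDerivAt_fst)
  exact (hasFDerivAt_snd.sub hstart).sub
    ((primitive E).hasFDerivAt.comp p (heval.clm_apply hdirection))

theorem contDiff_flowDefect (hT : ∀ x, HasFDerivAt T (T' x) x) :
    ContDiff ℝ 1 (flowDefect T) := by
  have hT_comp : ContDiff ℝ 1 fun p : (A × E) × C(unitInterval, E) => T.comp p.2 :=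
    (contDiff_superposition hT).comp contDiff_snd
  have heval : ContDiff ℝ 1 fun p : (A × E) × C(unitInterval, E) =>
      pointwiseEval unitInterval A E (T.comp p.2) :=
    (pointwiseEval unitInterval A E).contDiff.comp hT_comp
  have hdirection : ContDiff ℝ 1 fun p : (A × E) × C(unitInterval, E) =>
      ContinuousMap.const unitInterval p.1.1 :=
    (ContinuousLinearMap.const (M := A) ℝ unitInterval).contDiff.comp
      (contDiff_fst.comp contDiff_fst)
  have hstart : ContDiff ℝ 1 fun p : (A × E) × C(unitInterval, E) =>
      ContinuousMap.const unitInterval p.1.2 :=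
    (ContinuousLinearMap.const (M := E) ℝ unitInterval).contDiff.comp
      (contDiff_snd.comp contDiff_fst)
  exact (contDiff_snd.sub hstart).sub ((primitive E).contDiff.comp (heval.clm_apply hdirection))

theorem fderiv_flowDefect_comp_inr_isInvertible (hT : ∀ x, HasFDerivAt T (T' x) x) (x₀ : E) :
    (fderiv ℝ (flowDefect T) ((0, x₀), .const _ x₀) ∘L .inr ℝ _ _).IsInvertible := by
  have : fderiv ℝ (flowDefect T) ((0, x₀), .const _ x₀) ∘L .inr ℝ _ _ =
      .id ℝ C(unitInterval, E) := by
    ext1 h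
    rw [(hasFDerivAt_flowDefect hT _).fderiv, ContinuousLinearMap.comp_apply,
      ContinuousLinearMap.inr_apply]
    change flowDefectDeriv T T' _ ((0, 0), h) = h
    simp [flowDefectDeriv_apply]
  exact this ▸ ⟨.refl ℝ _, rfl⟩

variable [CompleteSpace E]

/-- Differentiating `s ↦ s • T (Y s) u` along an integral curve `Y` of `T · a` gives
`T (Y s) u + T' (Y s) (s • T (Y s) a) u`; commutation moves `u` into the direction of
differentiation. -/
theorem flowDefectDeriv_smul_eq_zero (hT : ∀ x, HasFDerivAt T (T' x) x) {a : A} {b : E}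
    {Y : C(unitInterval, E)} (hY : flowDefect T ((a, b), Y) = 0)
    (hcomm : ∀ s u v, T' (Y s) (T (Y s) u) v = T' (Y s) (T (Y s) v) u)
    {u : A} {w : C(unitInterval, E)} (hw : ∀ s, w s = (s : ℝ) • T (Y s) u) :
    flowDefectDeriv T T' ((a, b), Y) ((u, 0), w) = 0 := by
  rw [flowDefect, sub_sub, sub_eq_zero] at hY
  obtain ⟨y, hy, hyY⟩ := exists_hasDerivAt_of_eq_add_primitive fun t => DFunLike.congr_fun hY t
  rw [flowDefectDeriv_apply, sub_eq_zero]
  refine (sub_zero w).trans ?_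
  refine eq_primitive_of_hasDerivAt (y := fun s : ℝ => s • T (y s) u) (fun t => ?_)
    (zero_smul ℝ _) (fun t => by rw [hw, hyY])
  have hfield : HasDerivAt (fun s => T (y s) u) (T' (Y t) (T (Y t) a) u) t := by
    have := (hT (y t)).comp_hasDerivAt (t : ℝ) (hy t)
    rw [hyY] at this
    simpa using this.clm_apply (hasDerivAt_const (t : ℝ) u)
  refine ((hasDerivAt_id (t : ℝ)).smul hfield).congr_deriv ?_
  simp only [id, one_smul, ContinuousMap.add_apply, pointwiseEval_apply, ContinuousMap.comp_apply,
    ContinuousMap.const_apply, hw, hyY, map_smul, smul_apply, hcomm t a u]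
  exact add_comm _ _

theorem eventually_injective_flowDefectDeriv (hT : ∀ x, HasFDerivAt T (T' x) x) (x₀ : E) :
    ∀ᶠ p in 𝓝 ((0, x₀), .const _ x₀),
      Function.Injective fun h => flowDefectDeriv T T' p (0, h) := by
  obtain ⟨e, he⟩ := fderiv_flowDefect_comp_inr_isInvertible hT x₀
  have hcont : Continuous fun p => fderiv ℝ (flowDefect T) p ∘L .inr ℝ (A × E) _ :=
    ((contDiff_flowDefect hT).continuous_fderiv one_ne_zero).clm_comp continuous_const
  have hnhds := (hcont.continuousAt (x := ((0, x₀), .const _ x₀))).eventually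
    (he ▸ ContinuousLinearEquiv.nhds e)
  filter_upwards [hnhds] with p ⟨e', he'⟩
  rw [(hasFDerivAt_flowDefect hT p).fderiv] at he'
  have hinj : Function.Injective (flowDefectDeriv T T' p ∘L .inr ℝ (A × E) _) :=
    he' ▸ e'.injective
  exact hinj

variable [CompleteSpace A]

theorem exists_family_flowDefect_eq_zero (hT : ∀ x, HasFDerivAt T (T' x) x) (x₀ : E) :
    ∃ ψ : A × E → C(unitInterval, E), ContDiffAt ℝ 1 ψ (0, x₀) ∧
      (∀ᶠ p in 𝓝 (0, x₀), flowDefect T (p, ψ p) = 0) ∧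
      ∀ᶠ b in 𝓝 x₀, ψ (0, b) = .const _ b := by
  have hC := (contDiff_flowDefect hT).contDiffAt (x := ((0, x₀), .const _ x₀))
  have hinv := fderiv_flowDefect_comp_inr_isInvertible hT x₀
  refine ⟨hC.implicitFunction one_ne_zero hinv,
    hC.contDiffAt_implicitFunction one_ne_zero hinv, ?_, ?_⟩
  · filter_upwards [hC.eventually_apply_implicitFunction one_ne_zero hinv] with p hp
    rw [hp, flowDefect_const]
  · have hcont : ContinuousAt (fun b : E =>
        (((0 : A), b), ContinuousMap.const unitInterval b)) x₀ := by fun_prop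
    filter_upwards [hcont.eventually
      (hC.eventually_apply_eq_iff_implicitFunction one_ne_zero hinv)] with b hb
    exact hb.1 (by rw [flowDefect_const, flowDefect_const])

/-- The derivative of the family `ψ` of integral curves and `s ↦ s • T (Y s) u` solve the same
linearized equation, whose solutions are unique near `a = 0`. -/
theorem exists_jointFlow (hT : ∀ x, HasFDerivAt T (T' x) x) {x₀ : E}
    (hcomm : ∀ᶠ x in 𝓝 x₀, ∀ u v, T' x (T x u) v = T' x (T x v) u) :
    ∃ α : A × E → E, ContDiffAt ℝ 1 α (0, x₀) ∧ (∀ᶠ b in 𝓝 x₀, α (0, b) = b) ∧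
      ∀ᶠ p in 𝓝 ((0 : A), x₀), ∀ u, fderiv ℝ α p (u, 0) = T (α p) u := by
  obtain ⟨ψ, hψ, hzero, hconst⟩ := exists_family_flowDefect_eq_zero hT x₀
  let ev : C(unitInterval, E) →L[ℝ] E := ContinuousMap.evalCLM ℝ (1 : unitInterval)
  refine ⟨fun p => ψ p 1, ev.contDiff.contDiffAt.comp _ hψ,
    hconst.mono fun b hb => DFunLike.congr_fun hb 1, ?_⟩
  have hψ₀ : ψ (0, x₀) = .const _ x₀ := hconst.self_of_nhds
  have hgraph : Filter.Tendsto (fun p => (p, ψ p)) (𝓝 ((0 : A), x₀))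
      (𝓝 ((0, x₀), .const _ x₀)) :=
    hψ₀ ▸ (continuousAt_id.prodMk hψ.continuousAt).tendsto
  have hnear : ∀ᶠ p in 𝓝 ((0 : A), x₀), ∀ s u v,
      T' (ψ p s) (T (ψ p s) u) v = T' (ψ p s) (T (ψ p s) v) u := by
    obtain ⟨ε, hε, H⟩ := Metric.eventually_nhds_iff.1 hcomm
    filter_upwards [Metric.tendsto_nhds.1 hψ.continuousAt.tendsto ε hε] with p hp s
    rw [hψ₀] at hp
    exact H ((ContinuousMap.dist_apply_le_dist (g := .const _ x₀) s).trans_lt hp)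
  filter_upwards [hzero.eventually_nhds, hψ.eventually (by simp),
    hgraph.eventually (eventually_injective_flowDefectDeriv hT x₀), hnear] with p hp hd hinj hn u
  have hψp : HasFDerivAt ψ (fderiv ℝ ψ p) p := (hd.differentiableAt one_ne_zero).hasFDerivAt
  let w : C(unitInterval, E) := ⟨fun s => (s : ℝ) • T (ψ p s) u, by fun_prop⟩
  have hw : flowDefectDeriv T T' (p, ψ p) ((u, 0), w) = 0 :=
    flowDefectDeriv_smul_eq_zero hT hp.self_of_nhds hn fun _ => rfl
  have hcomp : HasFDerivAt (fun p => flowDefect T (p, ψ p)) _ p :=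
    HasFDerivAt.comp (g := flowDefect T) p (hasFDerivAt_flowDefect hT (p, ψ p))
      ((hasFDerivAt_id p).prodMk hψp)
  have hψu : flowDefectDeriv T T' (p, ψ p) ((u, 0), fderiv ℝ ψ p (u, 0)) = 0 :=
    DFunLike.congr_fun (hcomp.unique
      ((hasFDerivAt_const (0 : C(unitInterval, E)) p).congr_of_eventuallyEq hp)) (u, 0)
  have hsol : fderiv ℝ ψ p (u, 0) = w := by
    refine hinj (add_left_cancel (a := flowDefectDeriv T T' (p, ψ p) ((u, 0), 0)) ?_)
    simpa only [← map_add, Prod.mk_add_mk, add_zero, zero_add] using hψu.trans hw.symm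
  have hev : HasFDerivAt (fun p => ψ p 1) (ev ∘L fderiv ℝ ψ p) p := ev.hasFDerivAt.comp p hψp
  rw [hev.fderiv, ContinuousLinearMap.comp_apply, hsol]
  exact one_smul ℝ _

end JointFlow

section Calculus

variable {E : Type*} [NormedAddCommGroup E] [NormedSpace ℝ E]
  {F : Type*} [NormedAddCommGroup F] [NormedSpace ℝ F]

theorem exists_contDiff_eventuallyEq [HasContDiffBump E] {n : ℕ} {f : E → F} {x₀ : E}
    (hf : ContDiffAt ℝ n f x₀) : ∃ g : E → F, ContDiff ℝ n g ∧ g =ᶠ[𝓝 x₀] f := by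
  obtain ⟨r, hr, H⟩ := Metric.eventually_nhds_iff_ball.1 (hf.eventually (by simp))
  let χ : ContDiffBump x₀ := ⟨r / 3, r / 2, by positivity, by linarith⟩
  refine ⟨fun x => χ x • f x, contDiff_iff_contDiffAt.2 fun x => ?_, ?_⟩
  · by_cases hx : x ∈ Metric.ball x₀ r
    · exact χ.contDiff.contDiffAt.smul (H x hx)
    · have hχ : x ∉ tsupport χ := by
        rw [χ.tsupport_eq]
        exact fun h => hx (Metric.closedBall_subset_ball (half_lt_self hr) h)
      refine (contDiffAt_const (c := (0 : F))).congr_of_eventuallyEq ?_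
      filter_upwards [notMem_tsupport_iff_eventuallyEq.1 hχ] with y hy
      rw [hy, Pi.zero_apply, zero_smul]
  · filter_upwards [χ.eventuallyEq_one] with x hx
    rw [hx, Pi.one_apply, one_smul]

theorem fderiv_fderiv_of_eventually_leftInverse {f : E → F} {g : F → E} {x : E}
    (hg : DifferentiableAt ℝ g (f x)) (hf : DifferentiableAt ℝ f x)
    (h : ∀ᶠ y in 𝓝 x, g (f y) = y) (v : E) : fderiv ℝ g (f x) (fderiv ℝ f x v) = v :=
  DFunLike.congr_fun ((hg.hasFDerivAt.comp x hf.hasFDerivAt).unique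
    ((hasFDerivAt_id x).congr_of_eventuallyEq h)) v

theorem fderiv_apply_of_eventually_eq {α : F × E → E} {a : F} {x : E}
    (hα : DifferentiableAt ℝ α (a, x)) (h : ∀ᶠ y in 𝓝 x, α (a, y) = y) (v : E) :
    fderiv ℝ α (a, x) (0, v) = v :=
  DFunLike.congr_fun ((HasFDerivAt.comp (g := α) x hα.hasFDerivAt
    (hasFDerivAt_prodMk_right a x)).unique ((hasFDerivAt_id x).congr_of_eventuallyEq h)) v

theorem exists_contDiffAt_localInverse [CompleteSpace E] {f : E → F} {x : E} {e : E ≃L[ℝ] F}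
    (hf : ContDiffAt ℝ 1 f x) (he : HasFDerivAt f (e : E →L[ℝ] F) x) :
    ∃ g : F → E, ContDiffAt ℝ 1 g (f x) ∧ g (f x) = x ∧
      (∀ᶠ y in 𝓝 (f x), f (g y) = y) ∧ ∀ᶠ z in 𝓝 x, g (f z) = z := by
  have hstrict : HasStrictFDerivAt f (e : E →L[ℝ] F) x := hf.hasStrictFDerivAt' he one_ne_zero
  exact ⟨hstrict.localInverse f e x, hf.to_localInverse he one_ne_zero,
    hstrict.localInverse_apply_image, hstrict.eventually_right_inverse,
    hstrict.eventually_left_inverse⟩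

end Calculus

section Straightening

variable {A : Type*} [NormedAddCommGroup A] [NormedSpace ℝ A]
  {E : Type*} [NormedAddCommGroup E] [NormedSpace ℝ E]
  {F : Type*} [NormedAddCommGroup F] [NormedSpace ℝ F]
  {T : E → A →L[ℝ] E}

theorem exists_jointFlow_of_contDiffAt [HasContDiffBump E] [CompleteSpace E] [CompleteSpace A]
    {x₀ : E} (hT : ContDiffAt ℝ 1 T x₀)
    (hcomm : ∀ᶠ x in 𝓝 x₀, ∀ u v, fderiv ℝ T x (T x u) v = fderiv ℝ T x (T x v) u) :
    ∃ α : A × E → E, ContDiffAt ℝ 1 α (0, x₀) ∧ (∀ᶠ b in 𝓝 x₀, α (0, b) = b) ∧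
      ∀ᶠ p in 𝓝 ((0 : A), x₀), ∀ u, fderiv ℝ α p (u, 0) = T (α p) u := by
  obtain ⟨T₁, hT₁, heq⟩ := exists_contDiff_eventuallyEq (n := 1) (by exact_mod_cast hT)
  rw [Nat.cast_one] at hT₁
  have hcomm₁ : ∀ᶠ x in 𝓝 x₀, ∀ u v, fderiv ℝ T₁ x (T₁ x u) v = fderiv ℝ T₁ x (T₁ x v) u := by
    filter_upwards [hcomm, heq, heq.fderiv (𝕜 := ℝ)] with x hx h1 h2 u v
    rw [h1, h2, hx]
  obtain ⟨α, hα, hα₀, hα'⟩ := exists_jointFlow (T := ⟨T₁, hT₁.continuous⟩)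
    (T' := ⟨fderiv ℝ T₁, hT₁.continuous_fderiv one_ne_zero⟩)
    (fun x => (hT₁.differentiable one_ne_zero x).hasFDerivAt) hcomm₁
  have hα_tendsto : Filter.Tendsto α (𝓝 (0, x₀)) (𝓝 x₀) := by
    simpa only [hα₀.self_of_nhds] using hα.continuousAt.tendsto
  refine ⟨α, hα, hα₀, ?_⟩
  filter_upwards [hα', hα_tendsto.eventually heq] with p hp hp' u
  rw [hp, ContinuousMap.coe_mk, hp']

theorem exists_submersion_ker_eq_range [CompleteSpace A] [CompleteSpace F] {Θ : A × F → E}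
    {q₀ : A × F} {e : (A × F) ≃L[ℝ] E} (hΘ : ContDiffAt ℝ 1 Θ q₀)
    (he : HasFDerivAt Θ (e : A × F →L[ℝ] E) q₀)
    (hΘT : ∀ᶠ q in 𝓝 q₀, ∀ u, fderiv ℝ Θ q (u, 0) = T (Θ q) u) :
    ∃ t : E → F, ContDiffAt ℝ 1 t (Θ q₀) ∧ ∀ᶠ x in 𝓝 (Θ q₀),
      Function.Surjective (fderiv ℝ t x) ∧ (fderiv ℝ t x).ker = (T x).range := by
  obtain ⟨g, hg, hg₀, hΘg, hgΘ⟩ := exists_contDiffAt_localInverse hΘ he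
  have hg_tendsto : Filter.Tendsto g (𝓝 (Θ q₀)) (𝓝 q₀) := by
    simpa only [hg₀] using hg.continuousAt.tendsto
  refine ⟨fun x => (g x).2, contDiff_snd.contDiffAt.comp _ hg, ?_⟩
  filter_upwards [hΘg.eventually_nhds, hg_tendsto.eventually hgΘ.eventually_nhds,
    hg.eventually (by simp), hg_tendsto.eventually (hΘ.eventually (by simp)),
    hg_tendsto.eventually hΘT] with x hΘgx hgΘx hgx hΘx hT
  have hx : Θ (g x) = x := hΘgx.self_of_nhds
  have hg_diff := hgx.differentiableAt one_ne_zero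
  have hΘ_diff := hΘx.differentiableAt one_ne_zero
  have hright : ∀ v, fderiv ℝ Θ (g x) (fderiv ℝ g x v) = v :=
    fderiv_fderiv_of_eventually_leftInverse hΘ_diff hg_diff hΘgx
  have hleft : ∀ q, fderiv ℝ g x (fderiv ℝ Θ (g x) q) = q := by
    simpa only [hx] using
      fderiv_fderiv_of_eventually_leftInverse (by rwa [hx]) hΘ_diff hgΘx
  have ht : fderiv ℝ (fun x => (g x).2) x = .snd ℝ A F ∘L fderiv ℝ g x :=
    (hasFDerivAt_snd.comp x hg_diff.hasFDerivAt).fderiv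
  rw [hx] at hT
  rw [ht]
  refine ⟨fun c => ⟨fderiv ℝ Θ (g x) (0, c), congrArg Prod.snd (hleft _)⟩, ?_⟩
  ext v
  constructor
  · intro (hv : (fderiv ℝ g x v).2 = 0)
    refine ⟨(fderiv ℝ g x v).1, ?_⟩
    change T x _ = v
    rw [← hT, ← hv, Prod.mk.eta, hright]
  · rintro ⟨u, rfl⟩
    change (fderiv ℝ g x (T x u)).2 = 0
    rw [← hT, hleft]

variable [HasContDiffBump E] [CompleteSpace A] [CompleteSpace F]

/-- The joint flow of the commuting fields, started at the points of a transversal, is the inverse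
of a straightening chart. -/
theorem exists_straightening {x₀ : E} (hT : ContDiffAt ℝ 1 T x₀)
    (hcomm : ∀ᶠ x in 𝓝 x₀, ∀ u v, fderiv ℝ T x (T x u) v = fderiv ℝ T x (T x v) u)
    {e : (A × F) ≃L[ℝ] E} (he : ∀ u, e (u, 0) = T x₀ u) :
    ∃ t : E → F, ContDiffAt ℝ 1 t x₀ ∧ ∀ᶠ x in 𝓝 x₀,
      Function.Surjective (fderiv ℝ t x) ∧ (fderiv ℝ t x).ker = (T x).range := by
  have : CompleteSpace E :=
    (completeSpace_congr (e := e.toEquiv) e.isUniformEmbedding).1 inferInstance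
  obtain ⟨α, hα, hα₀, hα'⟩ := exists_jointFlow_of_contDiffAt hT hcomm
  let s : F →L[ℝ] E := e ∘L .inr ℝ A F
  let ι : A × F → A × E := fun q => (q.1, x₀ + s q.2)
  have hι : ∀ q, HasFDerivAt ι ((ContinuousLinearMap.fst ℝ A F).prod (s ∘L .snd ℝ A F)) q :=
    fun q => hasFDerivAt_fst.prodMk ((s.hasFDerivAt.comp q hasFDerivAt_snd).const_add x₀)
  have hι_contDiff : ContDiff ℝ 1 ι := by fun_prop
  have hι₀ : ι 0 = (0, x₀) := by simp [ι]
  have hι_tendsto : Filter.Tendsto ι (𝓝 0) (𝓝 (0, x₀)) := hι₀ ▸ hι_contDiff.continuous.tendsto 0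
  have hΘ₀ : α (ι 0) = x₀ := by rw [hι₀, hα₀.self_of_nhds]
  have hΘ : ContDiffAt ℝ 1 (fun q => α (ι q)) 0 :=
    ContDiffAt.comp (g := α) 0 (hι₀ ▸ hα) hι_contDiff.contDiffAt
  have hΘ' : ∀ q, ContDiffAt ℝ 1 α (ι q) → ∀ u c,
      fderiv ℝ (fun q => α (ι q)) q (u, c) = fderiv ℝ α (ι q) (u, s c) := by
    intro q hq u c
    have hcomp : HasFDerivAt (fun q => α (ι q)) _ q :=
      HasFDerivAt.comp (g := α) q (hq.differentiableAt one_ne_zero).hasFDerivAt (hι q)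
    rw [hcomp.fderiv]
    rfl
  have hΘT : ∀ᶠ q in 𝓝 0, ∀ u, fderiv ℝ (fun q => α (ι q)) q (u, 0) = T (α (ι q)) u := by
    filter_upwards [hι_tendsto.eventually hα', hι_tendsto.eventually (hα.eventually (by simp))]
      with q hq hαq u
    rw [hΘ' q hαq, map_zero, hq]
  have hderiv : fderiv ℝ (fun q => α (ι q)) 0 = (e : A × F →L[ℝ] E) := by
    refine ContinuousLinearMap.ext fun ⟨u, c⟩ => ?_
    have huc : fderiv ℝ α (0, x₀) (u, s c) = fderiv ℝ α (0, x₀) (u, 0) + s c := by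
      rw [← fderiv_apply_of_eventually_eq (hα.differentiableAt one_ne_zero) hα₀ (s c), ← map_add,
        fderiv_apply_of_eventually_eq (hα.differentiableAt one_ne_zero) hα₀, Prod.mk_add_mk,
        add_zero, zero_add]
    have hec : e (u, c) = e (u, 0) + s c := by
      rw [ContinuousLinearMap.comp_apply, ContinuousLinearMap.inr_apply,
        ContinuousLinearEquiv.coe_coe, ← map_add, Prod.mk_add_mk, add_zero, zero_add]
    rw [hΘ' 0 (hι₀ ▸ hα), hι₀, huc, hα'.self_of_nhds, hα₀.self_of_nhds, ← he, ← hec]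
    rfl
  exact hΘ₀ ▸ exists_submersion_ker_eq_range hΘ
    (hderiv ▸ (hΘ.differentiableAt one_ne_zero).hasFDerivAt) hΘT

end Straightening

/-! ### Frobenius' theorem -/

section Frames

variable {A : Type*} [NormedAddCommGroup A] [NormedSpace ℝ A]
  {E : Type*} [NormedAddCommGroup E] [NormedSpace ℝ E]

theorem exists_continuousLinearEquiv_prod_extending [FiniteDimensional ℝ A]
    [FiniteDimensional ℝ E] {F : Type*} [NormedAddCommGroup F] [NormedSpace ℝ F]
    [FiniteDimensional ℝ F] {L : A →L[ℝ] E} (hL : Function.Injective L)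
    (hdim : finrank ℝ E = finrank ℝ A + finrank ℝ F) :
    ∃ e : (A × F) ≃L[ℝ] E, ∀ u, e (u, 0) = L u := by
  obtain ⟨C, hC⟩ := Submodule.exists_isCompl L.range
  have hrange : finrank ℝ L.range = finrank ℝ A := LinearMap.finrank_range_of_inj hL
  have hcompl : finrank ℝ F = finrank ℝ C := by
    have := Submodule.finrank_add_eq_of_isCompl hC
    omega
  let e : (A × F) ≃ₗ[ℝ] E := ((LinearEquiv.ofInjective L.toLinearMap hL).prodCongr
    (LinearEquiv.ofFinrankEq F C hcompl)).trans (Submodule.prodEquivOfIsCompl L.range C hC)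
  exact ⟨e.toContinuousLinearEquiv, fun u => by simp [e]⟩

/-- `T y`, for `y` in the open set `W`, is a parametrization of the subspace `R y` which depends
smoothly on `y` and is a section of the fixed linear map `P`.  The normalization by `P` makes the
coordinate fields `y ↦ T y u` of an involutive family `R` commute. -/
structure IsNormalizedFrame (R : E → Submodule ℝ E) (W : Set E) (T : E → A →L[ℝ] E)
    (P : E →L[ℝ] A) : Prop where
  isOpen : IsOpen W
  contDiffOn : ContDiffOn ℝ ∞ T W
  left_inv : ∀ y ∈ W, Function.LeftInverse P (T y)
  range_eq : ∀ y ∈ W, (T y).range = R y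

theorem exists_isNormalizedFrame_range [FiniteDimensional ℝ E] [CompleteSpace A] {S : E → A →L[ℝ] E}
    {W : Set E} (hW : IsOpen W) (hS : ContDiffOn ℝ ∞ S W) {y₀ : E} (hy₀ : y₀ ∈ W)
    (hinj : Function.Injective (S y₀)) :
    ∃ W' ⊆ W, y₀ ∈ W' ∧ ∃ (T : E → A →L[ℝ] E) (P : E →L[ℝ] A),
      IsNormalizedFrame (fun y => (S y).range) W' T P := by
  obtain ⟨P₀, hP₀⟩ := LinearMap.exists_leftInverse_of_injective (S y₀).toLinearMap
    (LinearMap.ker_eq_bot.2 hinj)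
  let P : E →L[ℝ] A := LinearMap.toContinuousLinearMap P₀
  let B : E → A →L[ℝ] A := fun y => P ∘L S y
  have hB : ContDiffOn ℝ ∞ B W := contDiffOn_const.clm_comp hS
  have hB₀ : B y₀ = .id ℝ A := ContinuousLinearMap.ext fun u => DFunLike.congr_fun hP₀ u
  let O : Set (A →L[ℝ] A) := range ((↑) : (A ≃L[ℝ] A) → A →L[ℝ] A)
  refine ⟨W ∩ B ⁻¹' O, inter_subset_left, ⟨hy₀, .refl ℝ A, hB₀.symm⟩,
    fun y => S y ∘L (B y).inverse, P, ?_, ?_, ?_, ?_⟩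
  · exact hB.continuousOn.isOpen_inter_preimage hW ContinuousLinearEquiv.isOpen
  · refine (hS.mono inter_subset_left).clm_comp ?_
    rintro y ⟨hy, e, he⟩
    exact ContDiffAt.comp_contDiffWithinAt y (he ▸ contDiffAt_map_inverse e)
      ((hB y hy).mono inter_subset_left)
  · rintro y ⟨-, e, he⟩ u
    change B y ((B y).inverse u) = u
    rw [← he, ContinuousLinearMap.inverse_equiv]
    exact e.apply_symm_apply u
  · rintro y ⟨-, e, he⟩
    have hinv : Function.Surjective (B y).inverse := by
      rw [← he, ContinuousLinearMap.inverse_equiv]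
      exact e.symm.surjective
    exact LinearMap.range_comp_of_range_eq_top _ (LinearMap.range_eq_top.2 hinv)

namespace IsNormalizedFrame

variable {R : E → Submodule ℝ E} {W : Set E} {T : E → A →L[ℝ] E} {P : E →L[ℝ] A}
  (h : IsNormalizedFrame R W T P)
include h

theorem contDiffAt {y : E} (hy : y ∈ W) : ContDiffAt ℝ ∞ T y :=
  h.contDiffOn.contDiffAt (h.isOpen.mem_nhds hy)

theorem contDiffOn_apply (u : A) : ContDiffOn ℝ ∞ (fun y => T y u) W :=
  h.contDiffOn.clm_apply contDiffOn_const

theorem hasFDerivAt_apply {y : E} (hy : y ∈ W) (u : A) :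
    HasFDerivAt (fun y => T y u) ((fderiv ℝ T y).flip u) y :=
  HasFDerivAt.congr_fderiv (((h.contDiffAt hy).differentiableAt (by simp)).hasFDerivAt.clm_apply
    (hasFDerivAt_const u y)) (by simp)

theorem apply_fderiv {y : E} (hy : y ∈ W) (v : E) (u : A) : P (fderiv ℝ T y v u) = 0 := by
  have hconst : (fun y => P (T y u)) =ᶠ[𝓝 y] fun _ => u :=
    Filter.mem_of_superset (h.isOpen.mem_nhds hy) fun z hz => h.left_inv z hz u
  exact DFunLike.congr_fun ((P.hasFDerivAt.comp y (h.hasFDerivAt_apply hy u)).unique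
    ((hasFDerivAt_const u y).congr_of_eventuallyEq hconst)) v

/-- `P` annihilates the brackets of the fields `y ↦ T y u` and is injective on `R y`. -/
theorem fderiv_comm {y : E} (hy : y ∈ W) {u v : A}
    (hbracket : VectorField.lieBracket ℝ (fun y => T y u) (fun y => T y v) y ∈ R y) :
    fderiv ℝ T y (T y u) v = fderiv ℝ T y (T y v) u := by
  rw [← h.range_eq y hy, VectorField.lieBracket_eq] at hbracket
  obtain ⟨w, hw⟩ := hbracket
  simp only [(h.hasFDerivAt_apply hy _).fderiv, ContinuousLinearMap.flip_apply,
    ContinuousLinearMap.coe_coe] at hw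
  have hw₀ : w = 0 := by
    rw [← h.left_inv y hy w, hw, map_sub, h.apply_fderiv hy, h.apply_fderiv hy, sub_zero]
  rw [hw₀, map_zero] at hw
  exact sub_eq_zero.1 hw.symm

theorem exists_submersion_ker_eq [FiniteDimensional ℝ A] [FiniteDimensional ℝ E] {F : Type*}
    [NormedAddCommGroup F] [NormedSpace ℝ F] [FiniteDimensional ℝ F]
    (hdim : finrank ℝ E = finrank ℝ A + finrank ℝ F)
    (hbracket : ∀ y ∈ W, ∀ u v,
      VectorField.lieBracket ℝ (fun y => T y u) (fun y => T y v) y ∈ R y)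
    {y₀ : E} (hy₀ : y₀ ∈ W) :
    ∃ t : E → F, ContDiffAt ℝ 1 t y₀ ∧ ∀ᶠ y in 𝓝 y₀,
      Function.Surjective (fderiv ℝ t y) ∧ (fderiv ℝ t y).ker = R y := by
  have hW : W ∈ 𝓝 y₀ := h.isOpen.mem_nhds hy₀
  obtain ⟨e, he⟩ := exists_continuousLinearEquiv_prod_extending (h.left_inv y₀ hy₀).injective hdim
  have := FiniteDimensional.complete ℝ A
  have := FiniteDimensional.complete ℝ F
  obtain ⟨t, ht, ht'⟩ := exists_straightening ((h.contDiffAt hy₀).of_le (by simp))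
    (Filter.mem_of_superset hW fun y hy u v => h.fderiv_comm hy (hbracket y hy u v)) he
  refine ⟨t, ht, ?_⟩
  filter_upwards [ht', hW] with y hy hyW
  rwa [← h.range_eq y hyW]

end IsNormalizedFrame

end Frames

section FlowBox

variable {E : Type*} [NormedAddCommGroup E] [NormedSpace ℝ E]
  {M : Type*} [TopologicalSpace M] [ChartedSpace E M]

/-- `t` is a submersion on the open set `U` whose level sets are tangent to `Δ`. -/
structure IsFlowBox {F : Type*} [NormedAddCommGroup F] [NormedSpace ℝ F]
    (Δ : ∀ x : M, Submodule ℝ (TangentSpace 𝓘(ℝ, E) x)) (U : Set M) (t : M → F) : Prop where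
  isOpen : IsOpen U
  contMDiffAt : ∀ x ∈ U, ContMDiffAt 𝓘(ℝ, E) 𝓘(ℝ, F) 1 t x
  surjective : ∀ x ∈ U, Function.Surjective (dmap E F t x)
  ker_eq : ∀ x ∈ U, (dmap E F t x).ker = Δ x

/-- The distribution `Δ` in the preferred chart at `x₀`. -/
def chartDistribution (Δ : ∀ x : M, Submodule ℝ (TangentSpace 𝓘(ℝ, E) x)) (x₀ : M) (y : E) :
    Submodule ℝ E :=
  (Δ ((extChartAt 𝓘(ℝ, E) x₀).symm y)).map
    (dmap E E (extChartAt 𝓘(ℝ, E) x₀) ((extChartAt 𝓘(ℝ, E) x₀).symm y)).toLinearMap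

theorem mlieBracket_eq_lieBracket (X Y : E → E) :
    VectorField.mlieBracket 𝓘(ℝ, E) (M := E) X Y = VectorField.lieBracket ℝ X Y :=
  (VectorField.mlieBracketWithin_univ (I := 𝓘(ℝ, E)) (V := X) (W := Y)).symm.trans
    (VectorField.mlieBracketWithin_eq_lieBracketWithin.trans VectorField.lieBracketWithin_univ)

variable [IsManifold 𝓘(ℝ, E) ∞ M] {Δ : ∀ x : M, Submodule ℝ (TangentSpace 𝓘(ℝ, E) x)} {x₀ : M}

theorem contDiffOn_vectorField_chart {X : ∀ x : M, TangentSpace 𝓘(ℝ, E) x} {U : Set M}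
    (hUo : IsOpen U) (hU : U ⊆ (extChartAt 𝓘(ℝ, E) x₀).source)
    (hX : ContMDiffOn 𝓘(ℝ, E) 𝓘(ℝ, E).tangent ∞
      (fun x => (⟨x, X x⟩ : TangentBundle 𝓘(ℝ, E) M)) U) :
    ContDiffOn ℝ ∞ (fun y => (dmap E E (extChartAt 𝓘(ℝ, E) x₀)
      ((extChartAt 𝓘(ℝ, E) x₀).symm y) (X ((extChartAt 𝓘(ℝ, E) x₀).symm y)) : E))
      ((extChartAt 𝓘(ℝ, E) x₀).target ∩ (extChartAt 𝓘(ℝ, E) x₀).symm ⁻¹' U) := by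
  set φ := extChartAt 𝓘(ℝ, E) x₀ with hφ
  set e := trivializationAt E (TangentSpace 𝓘(ℝ, E) (M := M)) x₀ with he
  have hbase : φ.source = e.baseSet := by
    rw [hφ, he, extChartAt_source, TangentBundle.trivializationAt_baseSet]
  have hXφ : ContMDiffOn 𝓘(ℝ, E) 𝓘(ℝ, E) ∞ (fun y => (e ⟨φ.symm y, X (φ.symm y)⟩).2)
      (φ.target ∩ φ.symm ⁻¹' U) :=
    ((e.contMDiffOn_section_iff hUo (hU.trans hbase.subset)).1 hX).comp
      ((contMDiffOn_extChartAt_symm x₀).mono inter_subset_left) fun y hy => hy.2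
  refine hXφ.contDiffOn.congr fun y hy => ?_
  have hs : φ.symm y ∈ (chartAt E x₀).source := by
    rw [← extChartAt_source 𝓘(ℝ, E) x₀]
    exact hU hy.2
  have hdmap := TangentBundle.continuousLinearMapAt_trivializationAt (I := 𝓘(ℝ, E)) hs
  have hsnd : e.continuousLinearMapAt ℝ (φ.symm y) (X (φ.symm y)) =
      (e ⟨φ.symm y, X (φ.symm y)⟩).2 := by
    rw [Bundle.Trivialization.continuousLinearMapAt_apply,
      Bundle.Trivialization.linearMapAt_apply, if_pos (hbase ▸ hU hy.2)]
  exact (DFunLike.congr_fun hdmap (X (φ.symm y))).symm.trans hsnd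

theorem dmap_extChartAt_mem_chartDistribution {x : M}
    (hx : x ∈ (extChartAt 𝓘(ℝ, E) x₀).source) (v : TangentSpace 𝓘(ℝ, E) x) :
    (dmap E E (extChartAt 𝓘(ℝ, E) x₀) x v : E) ∈
      chartDistribution Δ x₀ (extChartAt 𝓘(ℝ, E) x₀ x) ↔ v ∈ Δ x := by
  rw [chartDistribution, (extChartAt 𝓘(ℝ, E) x₀).left_inv hx]
  have : IsManifold 𝓘(ℝ, E) 1 M := .of_le (n := ∞) (by simp)
  exact (isInvertible_mfderiv_extChartAt hx).injective.mem_set_image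
    (s := (Δ x : Set (TangentSpace 𝓘(ℝ, E) x)))

theorem IsInvolutive.lieBracket_mem_chartDistribution [CompleteSpace E] (hinv : IsInvolutive Δ)
    {W : Set E} (hWo : IsOpen W) (hW : W ⊆ (extChartAt 𝓘(ℝ, E) x₀).target) {X Y : E → E}
    (hX : ContDiffOn ℝ ∞ X W) (hY : ContDiffOn ℝ ∞ Y W)
    (hXΔ : ∀ y ∈ W, X y ∈ chartDistribution Δ x₀ y)
    (hYΔ : ∀ y ∈ W, Y y ∈ chartDistribution Δ x₀ y) {y : E} (hy : y ∈ W) :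
    VectorField.lieBracket ℝ X Y y ∈ chartDistribution Δ x₀ y := by
  set φ := extChartAt 𝓘(ℝ, E) x₀
  have : IsManifold 𝓘(ℝ, E) 1 M := .of_le (n := ∞) (by simp)
  have hsmoothness : minSmoothness ℝ 2 ≤ ∞ := by
    rw [minSmoothness_of_isRCLikeNormedField]
    exact ENat.LEInfty.out
  have : IsManifold 𝓘(ℝ, E) (minSmoothness ℝ 2) M := .of_le hsmoothness
  have hφ : ∀ x ∈ φ.source, ContMDiffAt 𝓘(ℝ, E) 𝓘(ℝ, E) ∞ φ x := fun x hx =>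
    contMDiffAt_extChartAt' (by rwa [extChartAt_source] at hx)
  have hφ' : ∀ x ∈ φ.source, (dmap E E φ x).IsInvertible := fun x hx =>
    isInvertible_mfderiv_extChartAt hx
  have hsection : ∀ {Z : E → E}, ContDiffOn ℝ ∞ Z W → ∀ z ∈ W,
      ContMDiffAt 𝓘(ℝ, E) 𝓘(ℝ, E).tangent ∞ (fun y => (⟨y, Z y⟩ : TangentBundle 𝓘(ℝ, E) E)) z :=
    fun hZ z hz => contMDiffAt_vectorSpace_iff_contDiffAt.2 (hZ.contDiffAt (hWo.mem_nhds hz))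
  let U : Set M := φ.source ∩ φ ⁻¹' W
  let pullback (Z : E → E) : ∀ x : M, TangentSpace 𝓘(ℝ, E) x :=
    VectorField.mpullback 𝓘(ℝ, E) 𝓘(ℝ, E) φ Z
  have hsmooth : ∀ {Z : E → E}, ContDiffOn ℝ ∞ Z W → ContMDiffOn 𝓘(ℝ, E) 𝓘(ℝ, E).tangent ∞
      (fun x => (⟨x, pullback Z x⟩ : TangentBundle 𝓘(ℝ, E) M)) U := fun hZ x hx =>
    (ContMDiffAt.mpullback_vectorField_preimage (hsection hZ _ hx.2) (hφ x hx.1) (hφ' x hx.1)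
      (by simp)).contMDiffWithinAt
  have hmem : ∀ {Z : E → E} {x}, x ∈ φ.source →
      (pullback Z x ∈ Δ x ↔ Z (φ x) ∈ chartDistribution Δ x₀ (φ x)) := by
    intro Z x hx
    rw [← dmap_extChartAt_mem_chartDistribution hx]
    exact iff_of_eq (congrArg (· ∈ chartDistribution Δ x₀ (φ x)) ((hφ' x hx).self_apply_inverse _))
  have hx : φ.symm y ∈ φ.source := φ.map_target (hW hy)
  have hφx : φ (φ.symm y) = y := φ.right_inv (hW hy)
  have hbracket := hinv U ((continuousOn_extChartAt x₀).isOpen_inter_preimage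
    (isOpen_extChartAt_source x₀) hWo) (pullback X) (pullback Y) (hsmooth hX) (hsmooth hY)
    (fun x hx => (hmem hx.1).2 (hXΔ _ hx.2)) (fun x hx => (hmem hx.1).2 (hYΔ _ hx.2))
    (φ.symm y) ⟨hx, by rwa [mem_preimage, hφx]⟩
  rw [← VectorField.mpullback_mlieBracket (n := ∞)
      ((hsection hX _ (by rwa [hφx])).mdifferentiableAt (by simp))
      ((hsection hY _ (by rwa [hφx])).mdifferentiableAt (by simp)) (hφ _ hx) hsmoothness,
    mlieBracket_eq_lieBracket] at hbracket
  rwa [hmem hx, hφx] at hbracket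

variable {r : ℕ}

theorem IsDistribution.finrank_chartDistribution (hΔ : IsDistribution Δ r) {y : E}
    (hy : y ∈ (extChartAt 𝓘(ℝ, E) x₀).target) : finrank ℝ (chartDistribution Δ x₀ y) = r := by
  have : IsManifold 𝓘(ℝ, E) 1 M := .of_le (n := ∞) (by simp)
  have hx := (extChartAt 𝓘(ℝ, E) x₀).map_target hy
  rw [← hΔ.1 ((extChartAt 𝓘(ℝ, E) x₀).symm y)]
  exact (LinearEquiv.finrank_eq (Submodule.equivMapOfInjective (dmap E E _ _).toLinearMap
    (isInvertible_mfderiv_extChartAt hx).injective _)).symm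

theorem IsDistribution.exists_frame_chart (hΔ : IsDistribution Δ r) (x₀ : M) :
    ∃ W ⊆ (extChartAt 𝓘(ℝ, E) x₀).target, IsOpen W ∧ extChartAt 𝓘(ℝ, E) x₀ x₀ ∈ W ∧
      ∃ σ : Fin r → E → E, (∀ i, ContDiffOn ℝ ∞ (σ i) W) ∧
        ∀ y ∈ W, Submodule.span ℝ (range fun i => σ i y) = chartDistribution Δ x₀ y := by
  obtain ⟨U, hUo, hxU, s, hs, hspan⟩ := hΔ.2 x₀
  set φ := extChartAt 𝓘(ℝ, E) x₀
  have hx₀ : x₀ ∈ φ.source := mem_extChartAt_source x₀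
  have hUφ : IsOpen (U ∩ φ.source) := hUo.inter (isOpen_extChartAt_source x₀)
  refine ⟨φ.target ∩ φ.symm ⁻¹' (U ∩ φ.source), inter_subset_left,
    (continuousOn_extChartAt_symm x₀).isOpen_inter_preimage (isOpen_extChartAt_target x₀) hUφ,
    ⟨φ.map_source hx₀, by rw [mem_preimage, φ.left_inv hx₀]; exact ⟨hxU, hx₀⟩⟩,
    fun i y => dmap E E φ (φ.symm y) (s i (φ.symm y)), fun i => ?_, fun y hy => ?_⟩
  · exact contDiffOn_vectorField_chart hUφ inter_subset_right ((hs i).mono inter_subset_left)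
  · rw [chartDistribution, hspan _ hy.2.1]
    let L : TangentSpace 𝓘(ℝ, E) (φ.symm y) →L[ℝ] E := dmap E E φ (φ.symm y)
    exact (congrArg (Submodule.span ℝ) (range_comp L fun i => s i (φ.symm y))).trans
      (Submodule.map_span L.toLinearMap _).symm

variable [FiniteDimensional ℝ E]

theorem IsDistribution.exists_isNormalizedFrame (hΔ : IsDistribution Δ r) (x₀ : M) :
    ∃ W ⊆ (extChartAt 𝓘(ℝ, E) x₀).target, extChartAt 𝓘(ℝ, E) x₀ x₀ ∈ W ∧
      ∃ (T : E → (Fin r → ℝ) →L[ℝ] E) (P : E →L[ℝ] (Fin r → ℝ)),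
        IsNormalizedFrame (chartDistribution Δ x₀) W T P := by
  obtain ⟨W, hW, hWo, hx₀, σ, hσ, hσspan⟩ := hΔ.exists_frame_chart x₀
  let S : E → (Fin r → ℝ) →L[ℝ] E := fun y =>
    LinearMap.toContinuousLinearMap (Fintype.linearCombination ℝ fun i => σ i y)
  have hS : ContDiffOn ℝ ∞ S W := contDiffOn_clm_apply.2 fun u => by
    simp only [S, LinearMap.coe_toContinuousLinearMap', Fintype.linearCombination_apply]
    exact ContDiffOn.sum fun i _ => contDiffOn_const.smul (hσ i)
  have hSrange : ∀ y ∈ W, (S y).range = chartDistribution Δ x₀ y := fun y hy =>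
    (Fintype.range_linearCombination ℝ _).trans (hσspan y hy)
  have hinj : Function.Injective (S (extChartAt 𝓘(ℝ, E) x₀ x₀)) := by
    refine linearIndependent_iff_injective_fintypeLinearCombination.1
      (linearIndependent_iff_card_eq_finrank_span.2 ?_)
    rw [Fintype.card_fin, Set.finrank, hσspan _ hx₀, hΔ.finrank_chartDistribution (hW hx₀)]
  obtain ⟨W', hW', hx₀', T, P, h⟩ := exists_isNormalizedFrame_range hWo hS hx₀ hinj
  exact ⟨W', hW'.trans hW, hx₀', T, P, h.isOpen, h.contDiffOn, h.left_inv,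
    fun y hy => (h.range_eq y hy).trans (hSrange y (hW' hy))⟩

theorem IsDistribution.exists_isFlowBox (hΔ : IsDistribution Δ r) (hinv : IsInvolutive Δ) (x₀ : M) :
    ∃ U : Set M, x₀ ∈ U ∧ ∃ t : M → (Fin (finrank ℝ E - r) → ℝ), IsFlowBox Δ U t := by
  obtain ⟨W, hW, hx₀W, T, P, h⟩ := hΔ.exists_isNormalizedFrame x₀
  have : FiniteDimensional ℝ (TangentSpace 𝓘(ℝ, E) x₀) := inferInstanceAs (FiniteDimensional ℝ E)
  have hr : r ≤ finrank ℝ E := hΔ.1 x₀ ▸ (Δ x₀).finrank_le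
  have : CompleteSpace E := FiniteDimensional.complete ℝ E
  have : IsManifold 𝓘(ℝ, E) 1 M := .of_le (n := ∞) (by simp)
  have hTΔ : ∀ u, ∀ y ∈ W, T y u ∈ chartDistribution Δ x₀ y := fun u y hy =>
    h.range_eq y hy ▸ ⟨u, rfl⟩
  obtain ⟨t, ht, ht'⟩ := h.exists_submersion_ker_eq (F := Fin (finrank ℝ E - r) → ℝ)
    (by rw [finrank_fin_fun, finrank_fin_fun, Nat.add_sub_cancel' hr])
    (fun y hy u v => hinv.lieBracket_mem_chartDistribution h.isOpen hW (h.contDiffOn_apply u)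
      (h.contDiffOn_apply v) (hTΔ u) (hTΔ v) hy) hx₀W
  obtain ⟨O, hO, hOo, hx₀O⟩ := mem_nhds_iff.1 ((ht.eventually (by simp)).and ht')
  set φ := extChartAt 𝓘(ℝ, E) x₀
  have hφ : ∀ x ∈ φ.source, ContMDiffAt 𝓘(ℝ, E) 𝓘(ℝ, E) 1 φ x := fun x hx =>
    contMDiffAt_extChartAt' (by rwa [extChartAt_source] at hx)
  have hdmap : ∀ x ∈ φ.source ∩ φ ⁻¹' O, dmap E _ (fun x => t (φ x)) x =
      (fderiv ℝ t (φ x)).comp (dmap E E φ x) := fun x hx => by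
    rw [← mfderiv_eq_fderiv]
    exact mfderiv_comp x ((hO hx.2).1.differentiableAt one_ne_zero).mdifferentiableAt
      ((hφ x hx.1).mdifferentiableAt one_ne_zero)
  refine ⟨φ.source ∩ φ ⁻¹' O, ⟨mem_extChartAt_source x₀, hx₀O⟩, fun x => t (φ x),
    (continuousOn_extChartAt x₀).isOpen_inter_preimage (isOpen_extChartAt_source x₀) hOo,
    fun x hx => (hO hx.2).1.contMDiffAt.comp x (hφ x hx.1), fun x hx => ?_, fun x hx => ?_⟩
  · rw [hdmap x hx]
    exact (hO hx.2).2.1.comp (isInvertible_mfderiv_extChartAt hx.1).surjective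
  · ext v
    rw [hdmap x hx, ← dmap_extChartAt_mem_chartDistribution hx.1, ← (hO hx.2).2.2]
    rfl

end FlowBox

/-! ### Level sets of submersions -/

section Charts

variable {E : Type*} [NormedAddCommGroup E] [NormedSpace ℝ E]
  {M : Type*} [TopologicalSpace M] [ChartedSpace E M]
  {E' : Type*} [NormedAddCommGroup E'] [NormedSpace ℝ E']
  {M' : Type*} [TopologicalSpace M'] [ChartedSpace E' M']
  {F : Type*} [NormedAddCommGroup F] [NormedSpace ℝ F]

variable (E F) in
/-- The tangent map of `f` at `x`, as a map between the model spaces, with which all tangent spaces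
are identified.  Its type does not depend on `x`, so that tangent maps at base points that are only
propositionally equal can be compared. -/
abbrev flatDmap {N : Type*} [TopologicalSpace N] [ChartedSpace F N] (f : M → N) (x : M) :
    E →L[ℝ] F :=
  dmap E F f x

theorem flatDmap_comp {N : Type*} [TopologicalSpace N] [ChartedSpace F N] {g : M' → N}
    {f : M → M'} {x : M} {y : M'} (hg : MDifferentiableAt 𝓘(ℝ, E') 𝓘(ℝ, F) g y)
    (hf : MDifferentiableAt 𝓘(ℝ, E) 𝓘(ℝ, E') f x) (hy : f x = y) :
    flatDmap E F (fun x => g (f x)) x = (flatDmap E' F g y).comp (flatDmap E E' f x) := by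
  subst hy
  exact mfderiv_comp x hg hf

theorem hasFDerivAt_chart {f : M → F} {x : M} (hf : MDifferentiableAt 𝓘(ℝ, E) 𝓘(ℝ, F) f x) :
    HasFDerivAt (f ∘ (extChartAt 𝓘(ℝ, E) x).symm) (flatDmap E F f x) (extChartAt 𝓘(ℝ, E) x x) := by
  have h := hf.hasMFDerivAt.2
  rw [ModelWithCorners.range_eq_univ] at h
  exact hasFDerivWithinAt_univ.1 h

theorem contDiffAt_chart {f : M → F} {x : M} {n : WithTop ℕ∞}
    (hf : ContMDiffAt 𝓘(ℝ, E) 𝓘(ℝ, F) n f x) :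
    ContDiffAt ℝ n (f ∘ (extChartAt 𝓘(ℝ, E) x).symm) (extChartAt 𝓘(ℝ, E) x x) := by
  have h := (contMDiffAt_iff.1 hf).2
  rw [ModelWithCorners.range_eq_univ, contDiffWithinAt_univ] at h
  exact h

variable [IsManifold 𝓘(ℝ, E) 1 M]

theorem contMDiffAt_extChartAt_symm_self (x : M) :
    ContMDiffAt 𝓘(ℝ, E) 𝓘(ℝ, E) 1 (extChartAt 𝓘(ℝ, E) x).symm (extChartAt 𝓘(ℝ, E) x x) :=
  (contMDiffOn_extChartAt_symm x).contMDiffAt (extChartAt_target_mem_nhds x)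

theorem flatDmap_extChartAt_symm_self (x : M) :
    flatDmap E E (extChartAt 𝓘(ℝ, E) x).symm (extChartAt 𝓘(ℝ, E) x x) = .id ℝ E := by
  have hφ := hasFDerivAt_chart
    ((contMDiffAt_extChartAt (I := 𝓘(ℝ, E)) (n := 1) (x := x)).mdifferentiableAt one_ne_zero)
  have hφ' : flatDmap E E (extChartAt 𝓘(ℝ, E) x) x = .id ℝ E :=
    hφ.unique ((hasFDerivAt_id _).congr_of_eventuallyEq
      (Filter.eventually_of_mem (extChartAt_target_mem_nhds x) fun y hy =>
        (extChartAt 𝓘(ℝ, E) x).right_inv hy))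
  have hcomp := flatDmap_comp
    ((contMDiffAt_extChartAt_symm_self (E := E) x).mdifferentiableAt one_ne_zero)
    ((contMDiffAt_extChartAt (I := 𝓘(ℝ, E)) (n := 1) (x := x)).mdifferentiableAt one_ne_zero) rfl
  rw [hφ', ContinuousLinearMap.comp_id] at hcomp
  exact hcomp.symm.trans ((hasMFDerivAt_id x).congr_of_eventuallyEq
    (Filter.eventually_of_mem (extChartAt_source_mem_nhds x) fun y hy =>
      (extChartAt 𝓘(ℝ, E) x).left_inv hy)).mfderiv

theorem eventually_eq_of_dmap_eq_zero {g : M → F} {x : M}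
    (hg : ∀ᶠ y in 𝓝 x, MDifferentiableAt 𝓘(ℝ, E) 𝓘(ℝ, F) g y ∧ flatDmap E F g y = 0) :
    ∀ᶠ y in 𝓝 x, g y = g x := by
  set φ := extChartAt 𝓘(ℝ, E) x
  have hφx : φ.symm (φ x) = x := extChartAt_to_inv x
  have hφ : Filter.Tendsto φ.symm (𝓝 (φ x)) (𝓝 (φ.symm (φ x))) := continuousAt_extChartAt_symm x
  rw [hφx] at hφ
  have hzero : ∀ᶠ y in 𝓝 (φ x), HasFDerivAt (𝕜 := ℝ) (g ∘ φ.symm) 0 y := by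
    filter_upwards [hφ.eventually hg, extChartAt_target_mem_nhds (I := 𝓘(ℝ, E)) x] with y hy hyt
    have hsymm : MDifferentiableAt 𝓘(ℝ, E) 𝓘(ℝ, E) φ.symm y :=
      ((contMDiffOn_extChartAt_symm (n := 1) x).contMDiffAt
        ((isOpen_extChartAt_target x).mem_nhds hyt)).mdifferentiableAt one_ne_zero
    have hcomp := (hy.1.comp y hsymm).hasMFDerivAt.hasFDerivAt
    refine hcomp.congr_fderiv ((flatDmap_comp hy.1 hsymm rfl).trans ?_)
    rw [hy.2, ContinuousLinearMap.zero_comp]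
  obtain ⟨ε, hε, hball⟩ := Metric.eventually_nhds_iff_ball.1 hzero
  filter_upwards [extChartAt_source_mem_nhds (I := 𝓘(ℝ, E)) x,
    (continuousAt_extChartAt (I := 𝓘(ℝ, E)) x).eventually (Metric.ball_mem_nhds _ hε)] with y hy hyε
  have hconst := Metric.isOpen_ball.is_const_of_fderiv_eq_zero (𝕜 := ℝ)
    (convex_ball (φ x) ε).isPreconnected
    (fun z hz => (hball z hz).differentiableAt.differentiableWithinAt)
    (fun z hz => (hball z hz).fderiv) hyε (Metric.mem_ball_self hε)
  exact (congrArg g (φ.left_inv hy)).symm.trans (hconst.trans (congrArg g hφx))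

end Charts

section LevelSets

variable {E : Type*} [NormedAddCommGroup E] [NormedSpace ℝ E]
  {M : Type*} [TopologicalSpace M] [ChartedSpace E M]
  {F : Type*} [NormedAddCommGroup F] [NormedSpace ℝ F]
  {K : Type*} [NormedAddCommGroup K] [NormedSpace ℝ K]

variable (E) in
/-- `β` parametrizes the level set of `f` through `x = β 0` near `x`, and `ρ` extends the coordinate
`β⁻¹` on that level set to a neighbourhood of `x` in `M`. -/
structure IsLevelSetParam (f : M → F) (x : M) (β : K → M) (ρ : M → K) : Prop where
  contMDiffAt_param : ContMDiffAt 𝓘(ℝ, K) 𝓘(ℝ, E) 1 β 0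
  contMDiffAt_coord : ContMDiffAt 𝓘(ℝ, E) 𝓘(ℝ, K) 1 ρ x
  param_zero : β 0 = x
  map_param : ∀ᶠ k in 𝓝 0, f (β k) = f x
  coord_param : ∀ᶠ k in 𝓝 0, ρ (β k) = k
  param_coord : ∀ᶠ y in 𝓝 x, f y = f x → β (ρ y) = y
  exists_eq_of_mem_ker : ∀ v, flatDmap E F f x v = 0 → ∃ k, flatDmap K E β 0 k = v

theorem exists_isLevelSetParam_vectorSpace [CompleteSpace E] [FiniteDimensional ℝ F] {f : E → F}
    {f' : E →L[ℝ] F} {a : E} (hf : ContDiffAt ℝ 1 f a) (hf' : HasFDerivAt f f' a)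
    (hsurj : Function.Surjective f') :
    ∃ (β : f'.ker → E) (ρ : E → f'.ker), IsLevelSetParam E f a β ρ := by
  have : CompleteSpace F := FiniteDimensional.complete ℝ F
  have hs : HasStrictFDerivAt f f' a := hf.hasStrictFDerivAt' hf' one_ne_zero
  have hr : f'.range = ⊤ := LinearMap.range_eq_top.2 hsurj
  have hk : f'.ker.ClosedComplemented :=
    ContinuousLinearMap.ker_closedComplemented_of_finiteDimensional_range f'
  set φ := HasStrictFDerivAt.implicitFunctionDataOfComplemented f f' hs hr hk
  have hρ : ContDiff ℝ 1 φ.rightFun :=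
    (Classical.choose hk).contDiff.comp (contDiff_id.sub contDiff_const)
  have hρa : φ.rightFun a = 0 := by
    change Classical.choose hk (a - a) = 0
    rw [sub_self, map_zero]
  have hprod : φ.prodFun φ.pt = (f a, 0) := Prod.ext rfl hρa
  have hmk : ContDiff ℝ 1 (fun k : f'.ker => (f a, k)) := contDiff_const.prodMk contDiff_id
  have hβ : ContDiffAt ℝ 1 (φ.implicitFunction (f a)) 0 :=
    ContDiffAt.comp (g := φ.implicitFunction.uncurry) (0 : f'.ker)
      (hprod ▸ φ.contDiffAt_implicitFunction hf hρ.contDiffAt one_ne_zero) hmk.contDiffAt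
  have hlevel : ∀ᶠ k in 𝓝 (0 : f'.ker), f (φ.implicitFunction (f a) k) = f a :=
    hmk.continuous.continuousAt.eventually (hs.map_implicitFunctionOfComplemented_eq hr hk)
  have hcoord : ∀ᶠ k in 𝓝 (0 : f'.ker), φ.rightFun (φ.implicitFunction (f a) k) = k :=
    hmk.continuous.continuousAt.eventually (hprod ▸ φ.rightFun_implicitFunction)
  refine ⟨φ.implicitFunction (f a), φ.rightFun, hβ.contMDiffAt, hρ.contDiffAt.contMDiffAt,
    hs.implicitFunctionOfComplemented_apply_image hr hk, hlevel, hcoord, ?_, fun v hv => ?_⟩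
  · filter_upwards [φ.implicitFunction_apply_image] with x hx hfx
    exact hfx ▸ hx
  · have hker : f' v = 0 := by
      rwa [← hf'.fderiv, ← mfderiv_eq_fderiv]
    have hβ' : flatDmap f'.ker E (φ.implicitFunction (f a)) 0 = f'.ker.subtypeL :=
      mfderiv_eq_fderiv.trans (hs.to_implicitFunctionOfComplemented hr hk).hasFDerivAt.fderiv
    exact ⟨⟨v, hker⟩, DFunLike.congr_fun hβ' _⟩

variable [IsManifold 𝓘(ℝ, E) 1 M]

theorem IsLevelSetParam.of_chart {f : M → F} {x : M} {β : K → E} {ρ : E → K}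
    (hf : MDifferentiableAt 𝓘(ℝ, E) 𝓘(ℝ, F) f x)
    (h : IsLevelSetParam E (f ∘ (extChartAt 𝓘(ℝ, E) x).symm) (extChartAt 𝓘(ℝ, E) x x) β ρ) :
    IsLevelSetParam E f x ((extChartAt 𝓘(ℝ, E) x).symm ∘ β) (ρ ∘ extChartAt 𝓘(ℝ, E) x) := by
  set φ := extChartAt 𝓘(ℝ, E) x
  have hφx : φ.symm (φ x) = x := extChartAt_to_inv x
  have hφ : ContMDiffAt 𝓘(ℝ, E) 𝓘(ℝ, E) 1 φ x := contMDiffAt_extChartAt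
  have hβ := h.contMDiffAt_param.continuousAt.tendsto
  rw [h.param_zero] at hβ
  refine ⟨?_, h.contMDiffAt_coord.comp x hφ, (congrArg φ.symm h.param_zero).trans hφx, ?_, ?_, ?_,
    fun v hv => ?_⟩
  · exact ContMDiffAt.comp 0 (h.param_zero ▸ contMDiffAt_extChartAt_symm_self x)
      h.contMDiffAt_param
  · simpa only [Function.comp_apply, hφx] using h.map_param
  · filter_upwards [h.coord_param, hβ.eventually (extChartAt_target_mem_nhds x)] with k hk hkt
    exact (congrArg ρ (φ.right_inv hkt)).trans hk
  · filter_upwards [hφ.continuousAt.eventually h.param_coord,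
      extChartAt_source_mem_nhds (I := 𝓘(ℝ, E)) x] with y hy hys hfy
    refine (congrArg φ.symm (hy ?_)).trans (φ.left_inv hys)
    simpa only [Function.comp_apply, φ.left_inv hys, hφx] using hfy
  · have hchart : flatDmap E F (f ∘ φ.symm) (φ x) v = 0 := by
      rwa [flatDmap, dmap, mfderiv_eq_fderiv, (hasFDerivAt_chart hf).fderiv]
    obtain ⟨k, hk⟩ := h.exists_eq_of_mem_ker v hchart
    refine ⟨k, ?_⟩
    have hcomp := flatDmap_comp
      ((contMDiffAt_extChartAt_symm_self (E := E) x).mdifferentiableAt one_ne_zero)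
      (h.contMDiffAt_param.mdifferentiableAt one_ne_zero) h.param_zero
    rw [flatDmap_extChartAt_symm_self, ContinuousLinearMap.id_comp] at hcomp
    exact (DFunLike.congr_fun hcomp k).trans hk

theorem exists_isLevelSetParam [CompleteSpace E] [FiniteDimensional ℝ F] {f : M → F} {x : M}
    (hf : ContMDiffAt 𝓘(ℝ, E) 𝓘(ℝ, F) 1 f x) (hsurj : Function.Surjective (flatDmap E F f x)) :
    ∃ (β : (flatDmap E F f x).ker → M) (ρ : M → (flatDmap E F f x).ker),
      IsLevelSetParam E f x β ρ := by
  have hfd := hf.mdifferentiableAt one_ne_zero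
  obtain ⟨β, ρ, h⟩ :=
    exists_isLevelSetParam_vectorSpace (contDiffAt_chart hf) (hasFDerivAt_chart hfd) hsurj
  exact ⟨_, _, h.of_chart hfd⟩

end LevelSets

section LevelSetFunctions

variable {E : Type*} [NormedAddCommGroup E] [NormedSpace ℝ E]
  {M : Type*} [TopologicalSpace M] [ChartedSpace E M]
  {F : Type*} [NormedAddCommGroup F] [NormedSpace ℝ F] {f : M → F} {x : M}

section Param

variable {K : Type*} [NormedAddCommGroup K] [NormedSpace ℝ K] {β : K → M} {ρ : M → K}

theorem IsLevelSetParam.coord_self (h : IsLevelSetParam E f x β ρ) : ρ x = 0 := by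
  simpa only [h.param_zero] using h.coord_param.self_of_nhds

theorem IsLevelSetParam.tendsto_param (h : IsLevelSetParam E f x β ρ) :
    Filter.Tendsto β (𝓝 0) (𝓝 x) := by
  simpa only [h.param_zero] using h.contMDiffAt_param.continuousAt.tendsto

theorem IsLevelSetParam.tendsto_coord (h : IsLevelSetParam E f x β ρ) :
    Filter.Tendsto ρ (𝓝 x) (𝓝 0) := by
  simpa only [h.coord_self] using h.contMDiffAt_coord.continuousAt.tendsto

theorem IsLevelSetParam.eventually_of_param (h : IsLevelSetParam E f x β ρ) {p : M → Prop}
    (hp : ∀ᶠ k in 𝓝 0, p (β k)) : ∀ᶠ y in 𝓝 x, f y = f x → p y := by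
  filter_upwards [h.param_coord, h.tendsto_coord.eventually hp] with y hy hpy hfy
  exact hy hfy ▸ hpy

theorem IsLevelSetParam.flatDmap_comp_param_eq_zero (h : IsLevelSetParam E f x β ρ) {G : Type*}
    [NormedAddCommGroup G] [NormedSpace ℝ G] {g : M → G}
    (hg : MDifferentiableAt 𝓘(ℝ, E) 𝓘(ℝ, G) g x) (hconst : ∀ᶠ k in 𝓝 0, g (β k) = g x) (k : K) :
    flatDmap E G g x (flatDmap K E β 0 k) = 0 := by
  have hcomp := flatDmap_comp hg (h.contMDiffAt_param.mdifferentiableAt one_ne_zero) h.param_zero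
  have hzero : flatDmap K G (fun k => g (β k)) 0 = 0 :=
    ((hasMFDerivAt_const (I := 𝓘(ℝ, K)) (g x) (0 : K)).congr_of_eventuallyEq hconst).mfderiv
  exact (DFunLike.congr_fun hcomp k).symm.trans (DFunLike.congr_fun hzero k)

theorem IsLevelSetParam.flatDmap_coord_param (h : IsLevelSetParam E f x β ρ) (k : K) :
    flatDmap E K ρ x (flatDmap K E β 0 k) = k := by
  have hcomp := flatDmap_comp (h.contMDiffAt_coord.mdifferentiableAt one_ne_zero)
    (h.contMDiffAt_param.mdifferentiableAt one_ne_zero) h.param_zero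
  have hid : flatDmap K K (fun k => ρ (β k)) 0 = .id ℝ K :=
    ((hasMFDerivAt_id (I := 𝓘(ℝ, K)) (0 : K)).congr_of_eventuallyEq h.coord_param).mfderiv
  exact (DFunLike.congr_fun hcomp k).symm.trans (DFunLike.congr_fun hid k)

/-- In the coordinates of the two level sets, `h` becomes `τ ∘ h ∘ β`. -/
theorem IsLevelSetParam.surjective_flatDmap_coord_comp_param (hβ : IsLevelSetParam E f x β ρ)
    {E' : Type*} [NormedAddCommGroup E'] [NormedSpace ℝ E']
    {N : Type*} [TopologicalSpace N] [ChartedSpace E' N]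
    {G : Type*} [NormedAddCommGroup G] [NormedSpace ℝ G]
    {K' : Type*} [NormedAddCommGroup K'] [NormedSpace ℝ K']
    {h : M → N} {Φ : N → G} {γ : K' → N} {τ : N → K'} (hγ : IsLevelSetParam E' Φ (h x) γ τ)
    (hh : MDifferentiableAt 𝓘(ℝ, E) 𝓘(ℝ, E') h x)
    (hΦ : MDifferentiableAt 𝓘(ℝ, E') 𝓘(ℝ, G) Φ (h x))
    (hker : ∀ w, flatDmap E' G Φ (h x) w = 0 →
      ∃ u, flatDmap E F f x u = 0 ∧ flatDmap E E' h x u = w) :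
    Function.Surjective (flatDmap K K' (fun k => τ (h (β k))) 0) := fun k => by
  obtain ⟨u, hu, huk⟩ := hker _ (hγ.flatDmap_comp_param_eq_zero hΦ hγ.map_param k)
  obtain ⟨l, rfl⟩ := hβ.exists_eq_of_mem_ker u hu
  have hτh := flatDmap_comp (hγ.contMDiffAt_coord.mdifferentiableAt one_ne_zero) hh rfl
  have hτhβ := flatDmap_comp ((hγ.contMDiffAt_coord.mdifferentiableAt one_ne_zero).comp x hh)
    (hβ.contMDiffAt_param.mdifferentiableAt one_ne_zero) hβ.param_zero
  refine ⟨l, (DFunLike.congr_fun hτhβ l).trans ((DFunLike.congr_fun hτh _).trans ?_)⟩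
  exact (congrArg (flatDmap E' K' τ (h x)) huk).trans (hγ.flatDmap_coord_param k)

end Param

variable [IsManifold 𝓘(ℝ, E) 1 M] [CompleteSpace E] [FiniteDimensional ℝ F]

/-- A level set of a submersion is locally connected, and a connected countable subset of a metric
space is a point. -/
theorem eventually_eq_of_countable {Y : Type*} [MetricSpace Y]
    (hf : ContMDiffAt 𝓘(ℝ, E) 𝓘(ℝ, F) 1 f x) (hsurj : Function.Surjective (flatDmap E F f x))
    {g : M → Y} (hg : ∀ᶠ y in 𝓝 x, ContinuousAt g y) {S : Set Y} (hS : S.Countable)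
    (hgS : ∀ᶠ y in 𝓝 x, f y = f x → g y ∈ S) : ∀ᶠ y in 𝓝 x, f y = f x → g y = g x := by
  obtain ⟨β, ρ, h⟩ := exists_isLevelSetParam hf hsurj
  have hβ : ∀ᶠ k in 𝓝 0, ContinuousAt β k :=
    ((contMDiffAt_iff_contMDiffAt_nhds (by simp)).1 h.contMDiffAt_param).mono
      fun _ hk => hk.continuousAt
  obtain ⟨ε, hε, hball⟩ := Metric.eventually_nhds_iff_ball.1
    (hβ.and (h.map_param.and (h.tendsto_param.eventually (hg.and hgS))))
  have hsub : ((g ∘ β) '' Metric.ball 0 ε).Subsingleton := by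
    have himage : (g ∘ β) '' Metric.ball 0 ε ⊆ S := by
      rintro _ ⟨k, hk, rfl⟩
      exact (hball k hk).2.2.2 (hball k hk).2.1
    refine (hS.mono himage).isTotallyDisconnected _ subset_rfl
      ((convex_ball _ _).isPreconnected.image _ fun k hk => ?_)
    exact ((hball k hk).2.2.1.comp (hball k hk).1).continuousWithinAt
  refine h.eventually_of_param (Filter.eventually_of_mem (Metric.ball_mem_nhds 0 hε) fun k hk => ?_)
  have hk₀ := hsub (mem_image_of_mem _ hk) (mem_image_of_mem _ (Metric.mem_ball_self hε))
  rwa [Function.comp_apply, Function.comp_apply, h.param_zero] at hk₀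

variable {G : Type*} [NormedAddCommGroup G] [NormedSpace ℝ G] {g : M → G}

theorem eventually_eq_of_dmap_ker_le (hf : ContMDiffAt 𝓘(ℝ, E) 𝓘(ℝ, F) 1 f x)
    (hsurj : Function.Surjective (flatDmap E F f x)) (hg : ContMDiffAt 𝓘(ℝ, E) 𝓘(ℝ, G) 1 g x)
    (hker : ∀ᶠ y in 𝓝 x, ∀ v, flatDmap E F f y v = 0 → flatDmap E G g y v = 0) :
    ∀ᶠ y in 𝓝 x, f y = f x → g y = g x := by
  obtain ⟨β, ρ, h⟩ := exists_isLevelSetParam hf hsurj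
  have hdiff : ∀ᶠ y in 𝓝 x, MDifferentiableAt 𝓘(ℝ, E) 𝓘(ℝ, F) f y ∧
      MDifferentiableAt 𝓘(ℝ, E) 𝓘(ℝ, G) g y :=
    (((contMDiffAt_iff_contMDiffAt_nhds (by simp)).1 hf).and
      ((contMDiffAt_iff_contMDiffAt_nhds (by simp)).1 hg)).mono
      fun _ hy => ⟨hy.1.mdifferentiableAt one_ne_zero, hy.2.mdifferentiableAt one_ne_zero⟩
  have hzero : ∀ᶠ k in 𝓝 0, MDifferentiableAt 𝓘(ℝ, (flatDmap E F f x).ker) 𝓘(ℝ, G)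
      (fun k => g (β k)) k ∧ flatDmap (flatDmap E F f x).ker G (fun k => g (β k)) k = 0 := by
    filter_upwards [(contMDiffAt_iff_contMDiffAt_nhds (by simp)).1 h.contMDiffAt_param,
      h.map_param.eventually_nhds, h.tendsto_param.eventually hdiff,
      h.tendsto_param.eventually hker] with k hβ hfβ hd hk
    have hβ' := hβ.mdifferentiableAt one_ne_zero
    have hconst : flatDmap (flatDmap E F f x).ker F (fun k => f (β k)) k = 0 :=
      ((hasMFDerivAt_const (I := 𝓘(ℝ, (flatDmap E F f x).ker)) (f x) k).congr_of_eventuallyEq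
        hfβ).mfderiv
    refine ⟨hd.2.comp k hβ', ContinuousLinearMap.ext fun u => ?_⟩
    rw [flatDmap_comp hd.1 hβ' rfl] at hconst
    exact (DFunLike.congr_fun (flatDmap_comp hd.2 hβ' rfl) u).trans
      (hk _ (DFunLike.congr_fun hconst u))
  exact h.eventually_of_param ((eventually_eq_of_dmap_eq_zero hzero).mono
    fun k hk => hk.trans (congrArg g h.param_zero))

theorem dmap_ker_le_of_eventually_eq (hf : ContMDiffAt 𝓘(ℝ, E) 𝓘(ℝ, F) 1 f x)
    (hsurj : Function.Surjective (flatDmap E F f x)) (hg : MDifferentiableAt 𝓘(ℝ, E) 𝓘(ℝ, G) g x)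
    (hfg : ∀ᶠ y in 𝓝 x, f y = f x → g y = g x) {v : E} (hv : flatDmap E F f x v = 0) :
    flatDmap E G g x v = 0 := by
  obtain ⟨β, ρ, h⟩ := exists_isLevelSetParam hf hsurj
  obtain ⟨k, rfl⟩ := h.exists_eq_of_mem_ker v hv
  refine h.flatDmap_comp_param_eq_zero hg ?_ k
  filter_upwards [h.map_param, h.tendsto_param.eventually hfg] with k hk hk'
  exact hk' hk

theorem eventually_mem_range_of_levelSet [FiniteDimensional ℝ G]
    (hf : ContMDiffAt 𝓘(ℝ, E) 𝓘(ℝ, F) 1 f x) (hsurj : Function.Surjective (flatDmap E F f x))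
    {E' : Type*} [NormedAddCommGroup E'] [NormedSpace ℝ E'] [CompleteSpace E']
    {N : Type*} [TopologicalSpace N] [ChartedSpace E' N] [IsManifold 𝓘(ℝ, E') 1 N]
    {h : M → N} (hh : ContMDiffAt 𝓘(ℝ, E) 𝓘(ℝ, E') 1 h x)
    {Φ : N → G} (hΦ : ContMDiffAt 𝓘(ℝ, E') 𝓘(ℝ, G) 1 Φ (h x))
    (hΦsurj : Function.Surjective (flatDmap E' G Φ (h x)))
    (hlevel : ∀ᶠ y in 𝓝 x, f y = f x → Φ (h y) = Φ (h x))
    (hker : ∀ w, flatDmap E' G Φ (h x) w = 0 →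
      ∃ u, flatDmap E F f x u = 0 ∧ flatDmap E E' h x u = w) :
    ∀ᶠ w in 𝓝 (h x), Φ w = Φ (h x) → w ∈ range h := by
  obtain ⟨β, ρ, hβ⟩ := exists_isLevelSetParam hf hsurj
  obtain ⟨γ, τ, hγ⟩ := exists_isLevelSetParam hΦ hΦsurj
  have hhβ₀ : h (β 0) = h x := congrArg h hβ.param_zero
  have hhβ : ContMDiffAt 𝓘(ℝ, (flatDmap E F f x).ker) 𝓘(ℝ, E') 1 (fun k => h (β k)) 0 :=
    ContMDiffAt.comp 0 (hβ.param_zero.symm ▸ hh) hβ.contMDiffAt_param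
  have hκ : ContMDiffAt 𝓘(ℝ, (flatDmap E F f x).ker) 𝓘(ℝ, (flatDmap E' G Φ (h x)).ker) 1
      (fun k => τ (h (β k))) 0 :=
    ContMDiffAt.comp 0 (hhβ₀.symm ▸ hγ.contMDiffAt_coord) hhβ
  have hκsurj := hβ.surjective_flatDmap_coord_comp_param hγ (hh.mdifferentiableAt one_ne_zero)
    (hΦ.mdifferentiableAt one_ne_zero) hker
  have hκnhds := (hκ.contDiffAt.hasStrictFDerivAt'
    (hκ.mdifferentiableAt one_ne_zero).hasMFDerivAt.hasFDerivAt one_ne_zero).map_nhds_eq_of_surj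
    (LinearMap.range_eq_top.2 hκsurj)
  rw [(congrArg τ hhβ₀).trans hγ.coord_self] at hκnhds
  have hgood : ∀ᶠ k in 𝓝 0, γ (τ (h (β k))) = h (β k) := by
    have hhβt : Filter.Tendsto (fun k => h (β k)) (𝓝 0) (𝓝 (h x)) :=
      hhβ₀ ▸ hhβ.continuousAt.tendsto
    filter_upwards [hβ.map_param, hβ.tendsto_param.eventually hlevel,
      hhβt.eventually hγ.param_coord] with k hk hk' hk''
    exact hk'' (hk' hk)
  have himage : ∀ᶠ l in 𝓝 0, γ l ∈ range h := by
    rw [← hκnhds, Filter.eventually_map]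
    exact hgood.mono fun k hk => ⟨β k, hk.symm⟩
  exact hγ.eventually_of_param himage

end LevelSetFunctions

/-! ### Leaves -/

section FlowBoxPullback

variable {E : Type*} [NormedAddCommGroup E] [NormedSpace ℝ E]
  {M : Type*} [TopologicalSpace M] [ChartedSpace E M]
  {F : Type*} [NormedAddCommGroup F] [NormedSpace ℝ F]
  {E' : Type*} [NormedAddCommGroup E'] [NormedSpace ℝ E']
  {N : Type*} [TopologicalSpace N] [ChartedSpace E' N]
  {Δ : ∀ x : M, Submodule ℝ (TangentSpace 𝓘(ℝ, E) x)} {U : Set M} {t : M → F} {f : N → M} {n : N}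

theorem IsFlowBox.contMDiffAt_comp (h : IsFlowBox Δ U t) (hf : ContMDiffAt 𝓘(ℝ, E') 𝓘(ℝ, E) 1 f n)
    (hn : f n ∈ U) : ContMDiffAt 𝓘(ℝ, E') 𝓘(ℝ, F) 1 (fun n => t (f n)) n :=
  (h.contMDiffAt _ hn).comp n hf

theorem IsFlowBox.flatDmap_comp (h : IsFlowBox Δ U t)
    (hf : MDifferentiableAt 𝓘(ℝ, E') 𝓘(ℝ, E) f n) (hn : f n ∈ U) :
    flatDmap E' F (fun n => t (f n)) n = (flatDmap E F t (f n)).comp (flatDmap E' E f n) :=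
  DiscreteMechanics.flatDmap_comp ((h.contMDiffAt _ hn).mdifferentiableAt one_ne_zero) hf rfl

theorem IsFlowBox.flatDmap_comp_eq_zero_iff (h : IsFlowBox Δ U t)
    (hf : MDifferentiableAt 𝓘(ℝ, E') 𝓘(ℝ, E) f n) (hn : f n ∈ U) {u : E'} :
    flatDmap E' F (fun n => t (f n)) n u = 0 ↔ dmap E' E f n u ∈ Δ (f n) := by
  rw [← h.ker_eq _ hn, h.flatDmap_comp hf hn]
  rfl

theorem IsFlowBox.surjective_flatDmap_comp (h : IsFlowBox Δ U t)
    (hf : MDifferentiableAt 𝓘(ℝ, E') 𝓘(ℝ, E) f n) (hn : f n ∈ U)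
    (hsurj : Function.Surjective (dmap E' E f n)) :
    Function.Surjective (flatDmap E' F (fun n => t (f n)) n) := by
  rw [h.flatDmap_comp hf hn]
  exact (h.surjective _ hn).comp hsurj

end FlowBoxPullback

section Plaques

variable {M F ι : Type*} {U : ι → Set M} {t : ι → M → F} {x y z : M}

/-- Two plaques of a family of flow boxes intersect.  The pair `(i, c)` encodes the plaque
`{x ∈ U i | t i x = c}`. -/
def PlaquesMeet (U : ι → Set M) (t : ι → M → F) (p q : ι × F) : Prop :=
  ∃ z ∈ U p.1 ∩ U q.1, t p.1 z = p.2 ∧ t q.1 z = q.2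

/-- `x` and `y` are in the same leaf: every plaque through `x` is joined to every plaque through `y`
by a chain of plaques, each of which intersects the next one. -/
def SameLeaf (U : ι → Set M) (t : ι → M → F) (x y : M) : Prop :=
  ∀ i j, x ∈ U i → y ∈ U j → Relation.ReflTransGen (PlaquesMeet U t) (i, t i x) (j, t j y)

theorem SameLeaf.of_eq {k : ι} (hx : x ∈ U k) (hy : y ∈ U k) (hxy : t k x = t k y) :
    SameLeaf U t x y := fun i _ hi hj =>
  have hfst : PlaquesMeet U t (i, t i x) (k, t k y) := ⟨x, ⟨hi, hx⟩, rfl, hxy⟩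
  Relation.ReflTransGen.tail (.single hfst) ⟨y, ⟨hy, hj⟩, rfl, rfl⟩

theorem SameLeaf.refl (x : M) : SameLeaf U t x x := fun _ _ hi hj =>
  .single ⟨x, ⟨hi, hj⟩, rfl, rfl⟩

theorem SameLeaf.symm (h : SameLeaf U t x y) : SameLeaf U t y x := fun i j hi hj =>
  have : Std.Symm (PlaquesMeet U t) := ⟨fun _ _ ⟨z, hz, h₁, h₂⟩ => ⟨z, hz.symm, h₂, h₁⟩⟩
  Std.Symm.symm _ _ (h j i hj hi)

theorem SameLeaf.trans (hU : ∀ y, ∃ i, y ∈ U i) (h : SameLeaf U t x y) (h' : SameLeaf U t y z) :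
    SameLeaf U t x z := fun i j hi hj =>
  have ⟨k, hk⟩ := hU y
  (h i k hi hk).trans (h' k j hk hj)

theorem countable_setOf_reflTransGen {α : Type*} {R : α → α → Prop}
    (hR : ∀ a, {b | R a b}.Countable) (a : α) : {b | Relation.ReflTransGen R a b}.Countable := by
  let successors : Set α → Set α := fun s => ⋃ b ∈ s, {c | R b c}
  have hiterate : ∀ n, (successors^[n] {a}).Countable := fun n => by
    induction n with
    | zero => exact countable_singleton a
    | succ n ih => exact Function.iterate_succ_apply' successors n _ ▸ ih.biUnion fun b _ => hR b
  refine (countable_iUnion hiterate).mono fun b (hab : Relation.ReflTransGen R a b) => ?_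
  induction hab with
  | refl => exact mem_iUnion.2 ⟨0, mem_singleton a⟩
  | tail _ hbc ih =>
    obtain ⟨n, hn⟩ := mem_iUnion.1 ih
    exact mem_iUnion.2 ⟨n + 1, Function.iterate_succ_apply' successors n _ ▸ mem_biUnion hn hbc⟩

end Plaques

section Leaves

variable {E : Type*} [NormedAddCommGroup E] [NormedSpace ℝ E]
  {M : Type*} [TopologicalSpace M] [ChartedSpace E M]
  {F : Type*} [NormedAddCommGroup F] [NormedSpace ℝ F]
  {Δ : ∀ x : M, Submodule ℝ (TangentSpace 𝓘(ℝ, E) x)}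
  {ι : Type*} {U : ι → Set M} {t : ι → M → F} {x y : M}

/-- `(U i, t i)` are flow boxes of `Δ` that cover `M`. -/
structure IsFlowBoxAtlas (Δ : ∀ x : M, Submodule ℝ (TangentSpace 𝓘(ℝ, E) x)) (U : ι → Set M)
    (t : ι → M → F) : Prop where
  isFlowBox : ∀ i, IsFlowBox Δ (U i) (t i)
  exists_mem : ∀ x, ∃ i, x ∈ U i

theorem IsJoinedBySmooth.sameLeaf (hUt : IsFlowBoxAtlas Δ U t) (h : IsJoinedBySmooth Δ x y) :
    SameLeaf U t x y := by
  obtain ⟨a, b, c, hab, hc, hcΔ, rfl, rfl⟩ := h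
  refine isPreconnected_Icc.induction₂ (fun s s' => SameLeaf U t (c s) (c s')) (fun s hs => ?_)
    (fun _ _ _ _ _ _ h h' => h.trans hUt.exists_mem h') (fun _ _ _ _ h => h.symm)
    (left_mem_Icc.2 hab.le) (right_mem_Icc.2 hab.le)
  obtain ⟨i, hi⟩ := hUt.exists_mem (c s)
  have hbox := hUt.isFlowBox i
  obtain ⟨ε, hε, hball⟩ := Metric.mem_nhdsWithin_iff.1
    ((hc s hs).continuousWithinAt.preimage_mem_nhdsWithin (hbox.isOpen.mem_nhds hi))
  have hderiv : ∀ τ ∈ Icc a b ∩ Metric.ball s ε,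
      HasFDerivWithinAt (𝕜 := ℝ) (fun τ => t i (c τ)) 0 (Icc a b ∩ Metric.ball s ε) τ := by
    intro τ hτ
    have hcU : c τ ∈ U i := hball hτ.symm
    have hcτ := ((hc τ hτ.1).mdifferentiableWithinAt (by simp)).hasMFDerivWithinAt
    have ht := ((hbox.contMDiffAt _ hcU).mdifferentiableAt one_ne_zero).hasMFDerivAt
    have hzero : (flatDmap E F (t i) (c τ)).comp
        (mfderivWithin 𝓘(ℝ, ℝ) 𝓘(ℝ, E) c (Icc a b) τ : ℝ →L[ℝ] E) = 0 :=
      ContinuousLinearMap.ext_ring ((hbox.ker_eq _ hcU).ge (hcΔ τ hτ.1))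
    have hcomp := (ht.comp_hasMFDerivWithinAt τ hcτ).hasFDerivWithinAt
    exact (hzero ▸ hcomp).mono inter_subset_left
  filter_upwards [inter_mem_nhdsWithin (Icc a b) (Metric.ball_mem_nhds s hε)] with s' hs'
  refine .of_eq hi (hball hs'.symm) ?_
  have hconvex := (convex_Icc a b).inter (convex_ball s ε)
  have hle := hconvex.norm_image_sub_le_of_norm_hasFDerivWithin_le (C := 0) hderiv (by simp)
    ⟨hs, Metric.mem_ball_self hε⟩ hs'
  rw [zero_mul, norm_le_zero_iff, sub_eq_zero] at hle
  exact hle.symm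

theorem IsReachable.sameLeaf (hUt : IsFlowBoxAtlas Δ U t) (h : IsReachable Δ x y) :
    SameLeaf U t x y := by
  induction h with
  | refl => exact .refl x
  | tail _ h ih => exact ih.trans hUt.exists_mem (h.sameLeaf hUt)

end Leaves

section CountableLeaves

variable {E : Type*} [NormedAddCommGroup E] [NormedSpace ℝ E] [CompleteSpace E]
  {M : Type*} [TopologicalSpace M] [ChartedSpace E M] [IsManifold 𝓘(ℝ, E) 1 M]
  [SecondCountableTopology M]
  {F : Type*} [NormedAddCommGroup F] [NormedSpace ℝ F] [FiniteDimensional ℝ F]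
  {Δ : ∀ x : M, Submodule ℝ (TangentSpace 𝓘(ℝ, E) x)}

theorem IsFlowBox.countable_image_levelSet {U U' : Set M} {t t' : M → F} (h : IsFlowBox Δ U t)
    (h' : IsFlowBox Δ U' t') (c : F) : (t' '' (U ∩ U' ∩ t ⁻¹' {c})).Countable := by
  have hloc : ∀ x ∈ U ∩ U' ∩ t ⁻¹' {c},
      {y | t y = t x → t' y = t' x} ∈ 𝓝[U ∩ U' ∩ t ⁻¹' {c}] x := by
    rintro x ⟨⟨hx, hx'⟩, -⟩
    refine mem_nhdsWithin_of_mem_nhds (eventually_eq_of_dmap_ker_le (h.contMDiffAt x hx)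
      (h.surjective x hx) (h'.contMDiffAt x hx') ?_)
    filter_upwards [h.isOpen.mem_nhds hx, h'.isOpen.mem_nhds hx'] with y hy hy' v hv
    exact (h'.ker_eq y hy').ge ((h.ker_eq y hy).le hv)
  obtain ⟨T, hTs, hT, hcover⟩ := TopologicalSpace.countable_cover_nhdsWithin hloc
  refine (hT.image t').mono ?_
  rintro _ ⟨y, hy, rfl⟩
  obtain ⟨x, hx, hxy⟩ := mem_iUnion₂.1 (hcover hy)
  exact ⟨x, hx, (hxy (hy.2.trans (hTs hx).2.symm)).symm⟩

variable {ι : Type*} [Countable ι] {U : ι → Set M} {t : ι → M → F}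

theorem IsFlowBoxAtlas.countable_plaquesMeet (hUt : IsFlowBoxAtlas Δ U t) (p : ι × F) :
    {q | PlaquesMeet U t p q}.Countable := by
  refine (countable_iUnion fun j => ((hUt.isFlowBox p.1).countable_image_levelSet
    (hUt.isFlowBox j) p.2).image (Prod.mk j)).mono ?_
  rintro ⟨j, d⟩ ⟨z, hz, hzp, hzd⟩
  exact mem_iUnion.2 ⟨j, d, ⟨z, ⟨hz, hzp⟩, hzd⟩, rfl⟩

theorem IsFlowBoxAtlas.countable_image_leaf (hUt : IsFlowBoxAtlas Δ U t) (x : M) (j : ι) :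
    (t j '' {y | y ∈ U j ∧ SameLeaf U t x y}).Countable := by
  obtain ⟨i, hi⟩ := hUt.exists_mem x
  have hreach := countable_setOf_reflTransGen hUt.countable_plaquesMeet (i, t i x)
  refine (hreach.image Prod.snd).mono ?_
  rintro _ ⟨y, ⟨hyj, hxy⟩, rfl⟩
  exact mem_image_of_mem Prod.snd (hxy i j hi hyj)

end CountableLeaves

theorem IsDistribution.exists_isFlowBoxAtlas {E : Type*} [NormedAddCommGroup E] [NormedSpace ℝ E]
    [FiniteDimensional ℝ E] {M : Type*} [TopologicalSpace M] [ChartedSpace E M]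
    [IsManifold 𝓘(ℝ, E) ∞ M] [SecondCountableTopology M]
    {Δ : ∀ x : M, Submodule ℝ (TangentSpace 𝓘(ℝ, E) x)} {r : ℕ}
    (hΔ : IsDistribution Δ r) (hinv : IsInvolutive Δ) :
    ∃ (s : Set M) (U : s → Set M) (t : s → M → (Fin (finrank ℝ E - r) → ℝ)),
      s.Countable ∧ IsFlowBoxAtlas Δ U t := by
  choose U hxU t hUt using hΔ.exists_isFlowBox hinv
  obtain ⟨s, hs, hcover⟩ := TopologicalSpace.countable_cover_nhds
    fun x => (hUt x).isOpen.mem_nhds (hxU x)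
  refine ⟨s, fun i => U i, fun i => t i, hs, fun i => hUt i, fun x => ?_⟩
  obtain ⟨i, hi, hxi⟩ := mem_iUnion₂.1 (hcover.ge (mem_univ x))
  exact ⟨⟨i, hi⟩, hxi⟩

section Reachable

variable {E : Type*} [NormedAddCommGroup E] [NormedSpace ℝ E] [CompleteSpace E]
  {M : Type*} [TopologicalSpace M] [ChartedSpace E M] [IsManifold 𝓘(ℝ, E) 1 M]
  [SecondCountableTopology M]
  {F : Type*} [NormedAddCommGroup F] [NormedSpace ℝ F] [FiniteDimensional ℝ F]
  {Δ : ∀ x : M, Submodule ℝ (TangentSpace 𝓘(ℝ, E) x)}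
  {ι : Type*} [Countable ι] {U : ι → Set M} {t : ι → M → F}
  {E' : Type*} [NormedAddCommGroup E'] [NormedSpace ℝ E'] [CompleteSpace E']
  {N : Type*} [TopologicalSpace N] [ChartedSpace E' N] [IsManifold 𝓘(ℝ, E') 1 N]
  {f g : N → M} {n : N}

/-- A plaque of `f n` is locally connected and is mapped by `g` into a single leaf, hence into
countably many plaques. -/
theorem IsFlowBoxAtlas.eventually_eq_of_isReachable (hUt : IsFlowBoxAtlas Δ U t)
    (hf : ContMDiffAt 𝓘(ℝ, E') 𝓘(ℝ, E) 1 f n) (hsurj : Function.Surjective (dmap E' E f n))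
    (hg : ContMDiffAt 𝓘(ℝ, E') 𝓘(ℝ, E) 1 g n) (hfg : ∀ n, IsReachable Δ (f n) (g n)) {i j : ι}
    (hi : f n ∈ U i) (hj : g n ∈ U j) :
    ∀ᶠ n' in 𝓝 n, t i (f n') = t i (f n) → t j (g n') = t j (g n) := by
  have hbox := hUt.isFlowBox i
  have htg : ∀ᶠ n' in 𝓝 n, ContinuousAt (fun n => t j (g n)) n' :=
    ((contMDiffAt_iff_contMDiffAt_nhds (by simp)).1
      ((hUt.isFlowBox j).contMDiffAt_comp hg hj)).mono fun _ h => h.continuousAt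
  refine eventually_eq_of_countable (hbox.contMDiffAt_comp hf hi)
    (hbox.surjective_flatDmap_comp (hf.mdifferentiableAt one_ne_zero) hi hsurj) htg
    (hUt.countable_image_leaf (f n) j) ?_
  filter_upwards [hf.continuousAt.preimage_mem_nhds (hbox.isOpen.mem_nhds hi),
    hg.continuousAt.preimage_mem_nhds ((hUt.isFlowBox j).isOpen.mem_nhds hj)] with n' hn' hn'j hfn'
  exact mem_image_of_mem _ ⟨hn'j, (SameLeaf.of_eq hi hn' hfn'.symm).trans hUt.exists_mem
    ((hfg n').sameLeaf hUt)⟩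

theorem IsFlowBoxAtlas.dmap_mem_of_isReachable (hUt : IsFlowBoxAtlas Δ U t)
    (hf : ContMDiffAt 𝓘(ℝ, E') 𝓘(ℝ, E) 1 f n) (hsurj : Function.Surjective (dmap E' E f n))
    (hg : ContMDiffAt 𝓘(ℝ, E') 𝓘(ℝ, E) 1 g n) (hfg : ∀ n, IsReachable Δ (f n) (g n))
    {u : TangentSpace 𝓘(ℝ, E') n} (hu : dmap E' E f n u ∈ Δ (f n)) :
    dmap E' E g n u ∈ Δ (g n) := by
  obtain ⟨i, hi⟩ := hUt.exists_mem (f n)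
  obtain ⟨j, hj⟩ := hUt.exists_mem (g n)
  have hfd := hf.mdifferentiableAt one_ne_zero
  have hbox := hUt.isFlowBox i
  have htg := (hUt.isFlowBox j).contMDiffAt_comp hg hj
  exact ((hUt.isFlowBox j).flatDmap_comp_eq_zero_iff (hg.mdifferentiableAt one_ne_zero) hj).1
    (dmap_ker_le_of_eventually_eq (hbox.contMDiffAt_comp hf hi)
      (hbox.surjective_flatDmap_comp hfd hi hsurj) (htg.mdifferentiableAt one_ne_zero)
      (hUt.eventually_eq_of_isReachable hf hsurj hg hfg hi hj)
      ((hbox.flatDmap_comp_eq_zero_iff hfd hi).2 hu))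

end Reachable

/-! ### Lie group actions -/

section Action

variable {EG : Type*} [NormedAddCommGroup EG] [NormedSpace ℝ EG]
  {G : Type*} [TopologicalSpace G] [ChartedSpace EG G] [Group G]
  {E : Type*} [NormedAddCommGroup E] [NormedSpace ℝ E]
  {M : Type*} [TopologicalSpace M] [ChartedSpace E M] [MulAction G M]
  [ContMDiffSMul 𝓘(ℝ, EG) 𝓘(ℝ, E) ∞ G M]

variable (EG G E) in
theorem contMDiff_orbit (x : M) : ContMDiff 𝓘(ℝ, EG) 𝓘(ℝ, E) ∞ fun g : G => g • x :=
  contMDiff_id.smul contMDiff_const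

variable (EG G E) in
theorem mdifferentiable_orbit (x : M) : MDifferentiable 𝓘(ℝ, EG) 𝓘(ℝ, E) fun g : G => g • x :=
  (contMDiff_orbit EG G E x).mdifferentiable (by simp)

theorem dmap_infGen {E' : Type*} [NormedAddCommGroup E'] [NormedSpace ℝ E']
    {N : Type*} [TopologicalSpace N] [ChartedSpace E' N] [MulAction G N]
    {f : M → N} (hf : ∀ (g : G) (x : M), f (g • x) = g • f x) {x : M}
    (hfd : MDifferentiableAt 𝓘(ℝ, E) 𝓘(ℝ, E') f x) (ξ : GroupLieAlgebra 𝓘(ℝ, EG) G) :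
    dmap E E' f x (infGen G x ξ) = infGen G (f x) ξ := by
  have hcomp := flatDmap_comp hfd (mdifferentiable_orbit EG G E x 1) (one_smul G x)
  simp only [hf] at hcomp
  exact (DFunLike.congr_fun hcomp ξ).symm

variable [LieGroup 𝓘(ℝ, EG) ∞ G]

theorem dmap_orbit_mem_range (x : M) (g : G) (w : TangentSpace 𝓘(ℝ, EG) g) :
    dmap EG E (fun g : G => g • x) g w ∈ (infGen (EG := EG) (E := E) G (g • x)).range := by
  have hmul : ContMDiff 𝓘(ℝ, EG) 𝓘(ℝ, EG) ∞ fun g' : G => g' * g⁻¹ := contMDiff_mul_right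
  have hcomp := flatDmap_comp (mdifferentiable_orbit EG G E (g • x) 1)
    (hmul.mdifferentiable (by simp) g) (mul_inv_cancel g)
  have horbit : (fun g' : G => (g' * g⁻¹) • (g • x)) = fun g' => g' • x := by
    funext g'
    rw [smul_smul, inv_mul_cancel_right]
  rw [horbit] at hcomp
  exact ⟨flatDmap EG EG (fun g' : G => g' * g⁻¹) g w, (DFunLike.congr_fun hcomp w).symm⟩

theorem IsFlowBox.eventually_smul_eq {F : Type*} [NormedAddCommGroup F] [NormedSpace ℝ F]
    {Δ : ∀ x : M, Submodule ℝ (TangentSpace 𝓘(ℝ, E) x)} {U : Set M} {t : M → F}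
    (h : IsFlowBox Δ U t)
    (hgen : ∀ (ξ : GroupLieAlgebra 𝓘(ℝ, EG) G) (x : M), infGen G x ξ ∈ Δ x) {x : M} (hx : x ∈ U) :
    ∀ᶠ g : G in 𝓝 1, t (g • x) = t x := by
  have : IsManifold 𝓘(ℝ, EG) 1 G := .of_le (n := ∞) (by simp)
  have hU : ∀ᶠ g : G in 𝓝 1, g • x ∈ U :=
    (contMDiff_orbit EG G E x).continuous.continuousAt.preimage_mem_nhds
      (h.isOpen.mem_nhds (by rwa [one_smul]))
  have hzero : ∀ᶠ g : G in 𝓝 1, MDifferentiableAt 𝓘(ℝ, EG) 𝓘(ℝ, F) (fun g : G => t (g • x)) g ∧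
      flatDmap EG F (fun g : G => t (g • x)) g = 0 := by
    filter_upwards [hU] with g hg
    have horbit := mdifferentiable_orbit EG G E x g
    refine ⟨((h.contMDiffAt _ hg).mdifferentiableAt one_ne_zero).comp g horbit,
      ContinuousLinearMap.ext fun w => (h.flatDmap_comp_eq_zero_iff horbit hg).2 ?_⟩
    obtain ⟨ξ, hξ⟩ := dmap_orbit_mem_range (E := E) x g w
    exact hξ ▸ hgen ξ (g • x)
  simpa only [one_smul] using eventually_eq_of_dmap_eq_zero hzero

end Action

theorem smul_mem_of_isClosed {G X : Type*} [TopologicalSpace G] [Group G] [ContinuousMul G]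
    [PreconnectedSpace G] [TopologicalSpace X] [MulAction G X] {s : Set X} (hs : IsClosed s)
    (hsmul : ∀ x ∈ s, ∀ᶠ g : G in 𝓝 1, g • x ∈ s) (g : G) {x : X} (hx : x ∈ s)
    (hcont : Continuous fun g : G => g • x) : g • x ∈ s := by
  have hopen : IsOpen {g : G | g • x ∈ s} := isOpen_iff_mem_nhds.2 fun g hg => by
    have hmul : Filter.Tendsto (fun g' : G => g' * g⁻¹) (𝓝 g) (𝓝 1) :=
      mul_inv_cancel g ▸ (continuous_mul_const g⁻¹).tendsto g
    filter_upwards [hmul.eventually (hsmul _ hg)] with g' hg'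
    rwa [smul_smul, inv_mul_cancel_right] at hg'
  have huniv := IsClopen.eq_univ ⟨hs.preimage hcont, hopen⟩
    ⟨1, show (1 : G) • x ∈ s by rwa [one_smul]⟩
  exact huniv.ge (mem_univ g)

/-! ### The velocity constraint -/

section LinearAlgebra

variable {A V Q : Type*} [AddCommGroup A] [Module ℝ A] [FiniteDimensional ℝ A]
  [AddCommGroup V] [Module ℝ V] [AddCommGroup Q] [Module ℝ Q] [FiniteDimensional ℝ Q]

/-- The preimage of `X` under `m ∘ a` has dimension `2 * r`, and `(m, p) ∘ a` embeds it into
`X × Y`. -/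
theorem mem_range_of_apply_mem {a : A →ₗ[ℝ] V} {m p : V →ₗ[ℝ] Q} {X Y : Submodule ℝ Q}
    {r : ℕ} (ha : Function.Injective a) (hmp : Function.Injective (m.prod p))
    (hma : Function.Surjective (m ∘ₗ a)) (hA : finrank ℝ A = finrank ℝ Q + r)
    (hX : finrank ℝ X = r) (hY : finrank ℝ Y = r) (hXY : ∀ u, m (a u) ∈ X → p (a u) ∈ Y)
    {v : V} (hv : m v ∈ X) (hv' : p v ∈ Y) : v ∈ LinearMap.range a := by
  let W : Submodule ℝ A := X.comap (m ∘ₗ a)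
  have hW : finrank ℝ W = r + r := by
    have hrank := LinearMap.finrank_range_add_finrank_ker (X.mkQ ∘ₗ m ∘ₗ a)
    have hsurj : Function.Surjective (X.mkQ ∘ₗ m ∘ₗ a) := X.mkQ_surjective.comp hma
    rw [LinearMap.range_eq_top.2 hsurj, finrank_top, Submodule.finrank_quotient, hA,
      hX, LinearMap.ker_comp, Submodule.ker_mkQ] at hrank
    have hle : r ≤ finrank ℝ Q := hX ▸ X.finrank_le
    change _ + finrank ℝ W = _ at hrank
    lia
  let L : W →ₗ[ℝ] X × Y :=
    ((m ∘ₗ a).restrict fun _ hu => hu).prod ((p ∘ₗ a).restrict fun u hu => hXY u hu)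
  have hL : Function.Injective L := fun u u' h =>
    Subtype.ext (ha (hmp (Prod.ext (congrArg (fun z => (z.1 : Q)) h)
      (congrArg (fun z => (z.2 : Q)) h))))
  obtain ⟨u, hu⟩ := (LinearMap.injective_iff_surjective_of_finrank_eq_finrank
    (by rw [finrank_prod, hX, hY, hW])).1 hL (⟨m v, hv⟩, ⟨p v, hv'⟩)
  exact ⟨u, hmp (Prod.ext (congrArg (fun z => (z.1 : Q)) hu) (congrArg (fun z => (z.2 : Q)) hu))⟩

end LinearAlgebra

section Differentials

variable {E : Type*} [NormedAddCommGroup E] [NormedSpace ℝ E]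
  {M : Type*} [TopologicalSpace M] [ChartedSpace E M]
  {F F' : Type*} [NormedAddCommGroup F] [NormedSpace ℝ F]
  [NormedAddCommGroup F'] [NormedSpace ℝ F']

theorem flatDmap_prodMk {f : M → F} {g : M → F'} {x : M}
    (hf : MDifferentiableAt 𝓘(ℝ, E) 𝓘(ℝ, F) f x) (hg : MDifferentiableAt 𝓘(ℝ, E) 𝓘(ℝ, F') g x) :
    flatDmap E (F × F') (fun x => (f x, g x)) x = (flatDmap E F f x).prod (flatDmap E F' g x) :=
  HasMFDerivAt.mfderiv ⟨hf.continuousAt.prodMk hg.continuousAt,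
    hf.hasMFDerivAt.2.prodMk hg.hasMFDerivAt.2⟩

end Differentials

section DiscreteTangentBundle

variable {EQ : Type*} [NormedAddCommGroup EQ] [NormedSpace ℝ EQ]
  {Q : Type*} [TopologicalSpace Q] [ChartedSpace EQ Q]
  {EV : Type*} [NormedAddCommGroup EV] [NormedSpace ℝ EV]
  {V : Type*} [TopologicalSpace V] [ChartedSpace EV V]
  {F F' : Type*} [NormedAddCommGroup F] [NormedSpace ℝ F]
  [NormedAddCommGroup F'] [NormedSpace ℝ F']

namespace DiscreteTangentBundle

variable (B : DiscreteTangentBundle EQ Q EV V)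

theorem mdifferentiable_plus : MDifferentiable 𝓘(ℝ, EV) 𝓘(ℝ, EQ) B.plus :=
  B.plus_submersive.smooth.mdifferentiable (by simp)

theorem mdifferentiable_minus : MDifferentiable 𝓘(ℝ, EV) 𝓘(ℝ, EQ) B.minus :=
  B.minus_submersive.smooth.mdifferentiable (by simp)

theorem injective_flatDmap_prod (v : V) :
    Function.Injective ((flatDmap EV EQ B.minus v).prod (flatDmap EV EQ B.plus v)) :=
  (injective_iff_map_eq_zero _).2 fun _ hw =>
    (B.ker_inf_ker v).le ⟨congrArg Prod.snd hw, congrArg Prod.fst hw⟩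

theorem surjective_flatDmap_prod [FiniteDimensional ℝ EQ] [FiniteDimensional ℝ EV] (v : V) :
    Function.Surjective ((flatDmap EV EQ B.minus v).prod (flatDmap EV EQ B.plus v)) :=
  (LinearMap.injective_iff_surjective_of_finrank_eq_finrank (f :=
    ((flatDmap EV EQ B.minus v).prod (flatDmap EV EQ B.plus v)).toLinearMap)
    (by rw [B.dim_eq, finrank_prod, two_mul])).1 (B.injective_flatDmap_prod v)

/-- The pair of maps `(t ∘ ∂⁻, t' ∘ ∂⁺)`, used with the coordinates `t` and `t'` of two flow boxes:
its level sets are the points of `V` with both endpoints in given plaques. -/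
def endpointMap (t : Q → F) (t' : Q → F') (v : V) : F × F' := (t (B.minus v), t' (B.plus v))

variable {Δ : ∀ q : Q, Submodule ℝ (TangentSpace 𝓘(ℝ, EQ) q)} {U U' : Set Q}
  {t : Q → F} {t' : Q → F'} {B} {v : V}

theorem contMDiffAt_endpointMap (h : IsFlowBox Δ U t) (h' : IsFlowBox Δ U' t')
    (hv : B.minus v ∈ U) (hv' : B.plus v ∈ U') :
    ContMDiffAt 𝓘(ℝ, EV) 𝓘(ℝ, F × F') 1 (B.endpointMap t t') v :=
  (h.contMDiffAt_comp (B.minus_submersive.smooth.of_le (by simp)).contMDiffAt hv).prodMk_space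
    (h'.contMDiffAt_comp (B.plus_submersive.smooth.of_le (by simp)).contMDiffAt hv')

theorem flatDmap_endpointMap (h : IsFlowBox Δ U t) (h' : IsFlowBox Δ U' t')
    (hv : B.minus v ∈ U) (hv' : B.plus v ∈ U') :
    flatDmap EV (F × F') (B.endpointMap t t') v =
      ((flatDmap EQ F t (B.minus v)).prodMap (flatDmap EQ F' t' (B.plus v))).comp
        ((flatDmap EV EQ B.minus v).prod (flatDmap EV EQ B.plus v)) := by
  have hminus := B.mdifferentiable_minus v
  have hplus := B.mdifferentiable_plus v
  have hpair := flatDmap_prodMk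
    (((h.contMDiffAt _ hv).mdifferentiableAt one_ne_zero).comp v hminus)
    (((h'.contMDiffAt _ hv').mdifferentiableAt one_ne_zero).comp v hplus)
  exact hpair.trans (congrArg₂ ContinuousLinearMap.prod (h.flatDmap_comp hminus hv)
    (h'.flatDmap_comp hplus hv'))

theorem surjective_flatDmap_endpointMap [FiniteDimensional ℝ EQ] [FiniteDimensional ℝ EV]
    (h : IsFlowBox Δ U t) (h' : IsFlowBox Δ U' t') (hv : B.minus v ∈ U) (hv' : B.plus v ∈ U') :
    Function.Surjective (flatDmap EV (F × F') (B.endpointMap t t') v) := by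
  rw [flatDmap_endpointMap h h' hv hv']
  exact ((h.surjective _ hv).prodMap (h'.surjective _ hv')).comp (B.surjective_flatDmap_prod v)

theorem flatDmap_endpointMap_eq_zero_iff (h : IsFlowBox Δ U t) (h' : IsFlowBox Δ U' t')
    (hv : B.minus v ∈ U) (hv' : B.plus v ∈ U') {w : EV} :
    flatDmap EV (F × F') (B.endpointMap t t') v w = 0 ↔
      dmap EV EQ B.minus v w ∈ Δ (B.minus v) ∧ dmap EV EQ B.plus v w ∈ Δ (B.plus v) := by
  rw [flatDmap_endpointMap h h' hv hv', ← h.ker_eq _ hv, ← h'.ker_eq _ hv']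
  exact Prod.ext_iff

end DiscreteTangentBundle

end DiscreteTangentBundle

section Systems

variable {EQ : Type*} [NormedAddCommGroup EQ] [NormedSpace ℝ EQ]
  {Q : Type*} [TopologicalSpace Q] [ChartedSpace EQ Q] [IsManifold 𝓘(ℝ, EQ) ∞ Q]
  {EV : Type*} [NormedAddCommGroup EV] [NormedSpace ℝ EV]
  {V : Type*} [TopologicalSpace V] [ChartedSpace EV V]
  {ED : Type*} [NormedAddCommGroup ED] [NormedSpace ℝ ED]
  {D : Type*} [TopologicalSpace D] [ChartedSpace ED D]

theorem DCLS.flatDmap_minus_incl (S : DCLS EQ Q EV V ED D) (d : D) :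
    flatDmap ED EQ (S.minus ∘ S.incl) d =
      (flatDmap EV EQ S.minus (S.incl d)).comp (flatDmap ED EV S.incl d) :=
  flatDmap_comp (S.mdifferentiable_minus _) (S.incl_emb.smooth.mdifferentiable (by simp) d) rfl

theorem DCLS.flatDmap_plus_incl (S : DCLS EQ Q EV V ED D) (d : D) :
    flatDmap ED EQ (S.plus ∘ S.incl) d =
      (flatDmap EV EQ S.plus (S.incl d)).comp (flatDmap ED EV S.incl d) :=
  flatDmap_comp (S.mdifferentiable_plus _) (S.incl_emb.smooth.mdifferentiable (by simp) d) rfl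

variable [FiniteDimensional ℝ EQ] [SecondCountableTopology Q] [FiniteDimensional ℝ ED]
  [IsManifold 𝓘(ℝ, ED) ∞ D]
  {F : Type*} [NormedAddCommGroup F] [NormedSpace ℝ F] [FiniteDimensional ℝ F]
  {S : DCLS EQ Q EV V ED D} {Δ : ∀ q : Q, Submodule ℝ (TangentSpace 𝓘(ℝ, EQ) q)}
  {ι : Type*} [Countable ι] {U : ι → Set Q} {t : ι → Q → F}

namespace DCLS.HasLinearConstraints

theorem mem_tangentConstraint (hS : S.HasLinearConstraints Δ) (hUt : IsFlowBoxAtlas Δ U t) {d : D}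
    {w : TangentSpace 𝓘(ℝ, EV) (S.incl d)}
    (hminus : dmap EV EQ S.minus (S.incl d) w ∈ Δ (S.minus (S.incl d)))
    (hplus : dmap EV EQ S.plus (S.incl d) w ∈ Δ (S.plus (S.incl d))) :
    w ∈ S.tangentConstraint d := by
  have : CompleteSpace EQ := FiniteDimensional.complete ℝ EQ
  have : CompleteSpace ED := FiniteDimensional.complete ℝ ED
  have : IsManifold 𝓘(ℝ, EQ) 1 Q := .of_le (n := ∞) (by simp)
  have : IsManifold 𝓘(ℝ, ED) 1 D := .of_le (n := ∞) (by simp)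
  obtain ⟨r, hΔ, hD⟩ := hS.distribution_dim
  refine mem_range_of_apply_mem (a := (flatDmap ED EV S.incl d).toLinearMap)
    (m := (flatDmap EV EQ S.minus (S.incl d)).toLinearMap)
    (p := (flatDmap EV EQ S.plus (S.incl d)).toLinearMap) (S.incl_emb.injective d)
    (S.injective_flatDmap_prod _) ?_ hD (hΔ.1 _) (hΔ.1 _) (fun u hu => ?_) hminus hplus
  · have hsurj := S.minus_incl_submersive.surjective d
    rwa [show dmap ED EQ (S.minus ∘ S.incl) d = _ from S.flatDmap_minus_incl d] at hsurj
  · have hu' := hUt.dmap_mem_of_isReachable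
      (S.minus_incl_submersive.smooth.of_le (by simp)).contMDiffAt
      (S.minus_incl_submersive.surjective d)
      (S.plus_incl_submersive.smooth.of_le (by simp)).contMDiffAt hS.reachable
      (DFunLike.congr_fun (S.flatDmap_minus_incl d) u ▸ hu)
    exact DFunLike.congr_fun (S.flatDmap_plus_incl d) u ▸ hu'

theorem eventually_mem_constraint [FiniteDimensional ℝ EV] [IsManifold 𝓘(ℝ, EV) ∞ V]
    (hS : S.HasLinearConstraints Δ) (hUt : IsFlowBoxAtlas Δ U t) {i j : ι} {d : D}
    (hi : S.minus (S.incl d) ∈ U i) (hj : S.plus (S.incl d) ∈ U j) :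
    ∀ᶠ v in 𝓝 (S.incl d), S.endpointMap (t i) (t j) v = S.endpointMap (t i) (t j) (S.incl d) →
      v ∈ S.constraint := by
  have : CompleteSpace EQ := FiniteDimensional.complete ℝ EQ
  have : CompleteSpace EV := FiniteDimensional.complete ℝ EV
  have : CompleteSpace ED := FiniteDimensional.complete ℝ ED
  have : IsManifold 𝓘(ℝ, EQ) 1 Q := .of_le (n := ∞) (by simp)
  have : IsManifold 𝓘(ℝ, EV) 1 V := .of_le (n := ∞) (by simp)
  have : IsManifold 𝓘(ℝ, ED) 1 D := .of_le (n := ∞) (by simp)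
  have hminus : ContMDiffAt 𝓘(ℝ, ED) 𝓘(ℝ, EQ) 1 (S.minus ∘ S.incl) d :=
    (S.minus_incl_submersive.smooth.of_le (by simp)).contMDiffAt
  have hminusd := hminus.mdifferentiableAt one_ne_zero
  have hsurj := S.minus_incl_submersive.surjective d
  have hlevel := hUt.eventually_eq_of_isReachable hminus hsurj
    (S.plus_incl_submersive.smooth.of_le (by simp)).contMDiffAt hS.reachable hi hj
  refine eventually_mem_range_of_levelSet ((hUt.isFlowBox i).contMDiffAt_comp hminus hi)
    ((hUt.isFlowBox i).surjective_flatDmap_comp hminusd hi hsurj)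
    (S.incl_emb.smooth.of_le (by simp)).contMDiffAt
    (S.contMDiffAt_endpointMap (hUt.isFlowBox i) (hUt.isFlowBox j) hi hj)
    (S.surjective_flatDmap_endpointMap (hUt.isFlowBox i) (hUt.isFlowBox j) hi hj)
    (hlevel.mono fun d' hd' h => Prod.ext h (hd' h)) fun w hw => ?_
  obtain ⟨hw, hw'⟩ := (S.flatDmap_endpointMap_eq_zero_iff (hUt.isFlowBox i) (hUt.isFlowBox j)
    hi hj).1 hw
  obtain ⟨u, rfl⟩ := hS.mem_tangentConstraint hUt hw hw'
  refine ⟨u, ((hUt.isFlowBox i).flatDmap_comp_eq_zero_iff hminusd hi).2 ?_, rfl⟩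
  exact DFunLike.congr_fun (S.flatDmap_minus_incl d) u ▸ hw

end DCLS.HasLinearConstraints

end Systems

/-! ### Momentum conservation and symmetry -/

section MomentumConservation

variable {EQ : Type*} [NormedAddCommGroup EQ] [NormedSpace ℝ EQ]
  {Q : Type*} [TopologicalSpace Q] [ChartedSpace EQ Q] [IsManifold 𝓘(ℝ, EQ) ∞ Q]
  {EV : Type*} [NormedAddCommGroup EV] [NormedSpace ℝ EV]
  {V : Type*} [TopologicalSpace V] [ChartedSpace EV V]

namespace DiscreteTangentBundle

variable [FiniteDimensional ℝ EQ] [FiniteDimensional ℝ EV]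
  (B : DiscreteTangentBundle EQ Q EV V) (v : V) (w : TangentSpace 𝓘(ℝ, EV) v)

theorem plusPart_add_minusPart : B.plusPart v w + B.minusPart v w = w :=
  Submodule.projection_add_projection_eq_self (B.isCompl_vert v) w

theorem dmap_minus_plusPart : dmap EV EQ B.minus v (B.plusPart v w) = 0 :=
  Submodule.projection_apply_mem (B.isCompl_vert v) w

theorem dmap_plus_minusPart : dmap EV EQ B.plus v (B.minusPart v w) = 0 :=
  Submodule.projection_apply_mem (B.isCompl_vert v).symm w

theorem dmap_plus_plusPart : dmap EV EQ B.plus v (B.plusPart v w) = dmap EV EQ B.plus v w := by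
  conv_rhs => rw [← B.plusPart_add_minusPart v w, map_add, dmap_plus_minusPart, add_zero]

theorem dmap_minus_minusPart :
    dmap EV EQ B.minus v (B.minusPart v w) = dmap EV EQ B.minus v w := by
  conv_rhs => rw [← B.plusPart_add_minusPart v w, map_add, dmap_minus_plusPart, zero_add]

end DiscreteTangentBundle

variable {ED : Type*} [NormedAddCommGroup ED] [NormedSpace ℝ ED]
  {D : Type*} [TopologicalSpace D] [ChartedSpace ED D]
  {S : DCLS EQ Q EV V ED D} {Δ : ∀ q : Q, Submodule ℝ (TangentSpace 𝓘(ℝ, EQ) q)}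
  {G : Type*} [Group G] [MulAction G V]

namespace DCLS

theorem HasLinearConstraints.isInvariantForce [MulAction G Q] (hS : S.HasLinearConstraints Δ)
    (hplus : ∀ (g : G) (v : V), S.plus (g • v) = g • S.plus v)
    (hΔ : IsInvariantDistribution G Δ) : S.IsInvariantForce G := by
  intro g d d' hd
  have hcongr : ∀ q q' : Q, q = q' → (Δ q : Submodule ℝ EQ) = (Δ q' : Submodule ℝ EQ) := by
    rintro q _ rfl
    rfl
  rw [hS.force_eq d, hS.force_eq d']
  exact (hΔ g _).trans (hcongr _ _ (by rw [hd, hplus]))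

variable {EG : Type*} [NormedAddCommGroup EG] [NormedSpace ℝ EG]
  [TopologicalSpace G] [ChartedSpace EG G]

section Momentum

variable [FiniteDimensional ℝ EQ] [FiniteDimensional ℝ EV]

theorem momentumPlus_eq_momentumMinus {v : V}
    (h : ∀ ξ : GroupLieAlgebra 𝓘(ℝ, EG) G, S.σ v (infGen G v ξ) = 0) :
    S.momentumPlus (EG := EG) G v = S.momentumMinus G v := by
  ext ξ
  have hsum := h ξ
  rw [← S.plusPart_add_minusPart v (infGen G v ξ), map_add] at hsum
  exact eq_neg_of_add_eq_zero_left hsum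

variable [MulAction G Q] [ContMDiffSMul 𝓘(ℝ, EG) 𝓘(ℝ, EV) ∞ G V]
  (hplus : ∀ (g : G) (v : V), S.plus (g • v) = g • S.plus v)
  (hminus : ∀ (g : G) (v : V), S.minus (g • v) = g • S.minus v)

include hplus hminus

/-- The principle is tested on the variations `(ξ v)⁺` and `(ξ v')⁻`, which both project to the
generator at the intermediate point `∂⁺ v = ∂⁻ v'`. -/
theorem IsSolutionPair.momentumMinus_eq {d d' : D} (h : S.IsSolutionPair d d')
    (hforce : ∀ ξ : GroupLieAlgebra 𝓘(ℝ, EG) G, infGen G (S.plus (S.incl d)) ξ ∈ S.force d) :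
    S.momentumMinus (EG := EG) G (S.incl d') = S.momentumPlus G (S.incl d) := by
  obtain ⟨hdd', hσ⟩ := h
  ext ξ
  have hp : dmap EV EQ S.plus (S.incl d) (S.plusPart (S.incl d) (infGen G (S.incl d) ξ)) =
      infGen G (S.plus (S.incl d)) ξ :=
    (S.dmap_plus_plusPart _ _).trans (dmap_infGen hplus (S.mdifferentiable_plus _) ξ)
  have hm : dmap EV EQ S.minus (S.incl d') (S.minusPart (S.incl d') (infGen G (S.incl d') ξ)) =
      infGen G (S.minus (S.incl d')) ξ :=
    (S.dmap_minus_minusPart _ _).trans (dmap_infGen hminus (S.mdifferentiable_minus _) ξ)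
  have hmid : (infGen G (S.plus (S.incl d)) ξ : EQ) = infGen G (S.minus (S.incl d')) ξ := by
    rw [hdd']
  exact (eq_neg_of_add_eq_zero_left (hσ _ _ (S.dmap_minus_plusPart _ _)
    (S.dmap_plus_minusPart _ _) (hp.trans (hmid.trans hm.symm)) (hp ▸ hforce ξ))).symm

theorem IsEvolution.conservesMomentum {F : V → V} {U W : Set V} (hF : S.IsEvolution F U W)
    (hforce : ∀ d, ∀ ξ : GroupLieAlgebra 𝓘(ℝ, EG) G, infGen G (S.plus (S.incl d)) ξ ∈ S.force d)
    (hσ : ∀ v ∈ S.constraint, ∀ ξ : GroupLieAlgebra 𝓘(ℝ, EG) G, S.σ v (infGen G v ξ) = 0) :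
    S.ConservesMomentum (EG := EG) G F U := by
  rintro _ ⟨hU, d, rfl⟩
  obtain ⟨d', hd', hsol⟩ := hF.solution d hU
  have heq := momentumPlus_eq_momentumMinus (hσ _ ⟨d', rfl⟩)
  rw [← hd']
  exact ⟨momentumPlus_eq_momentumMinus (hσ _ ⟨d, rfl⟩), heq,
    heq.trans (hsol.momentumMinus_eq hplus hminus (hforce d))⟩

end Momentum

namespace HasLinearConstraints

variable [FiniteDimensional ℝ EQ] [SecondCountableTopology Q] [FiniteDimensional ℝ ED]
  [IsManifold 𝓘(ℝ, ED) ∞ D] [MulAction G Q] [ContMDiffSMul 𝓘(ℝ, EG) 𝓘(ℝ, EV) ∞ G V]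
  (hS : S.HasLinearConstraints Δ) (hinv : IsInvolutive Δ)
  (hplus : ∀ (g : G) (v : V), S.plus (g • v) = g • S.plus v)
  (hminus : ∀ (g : G) (v : V), S.minus (g • v) = g • S.minus v)
  (hgen : ∀ (ξ : GroupLieAlgebra 𝓘(ℝ, EG) G) (q : Q), infGen G q ξ ∈ Δ q)

include hS hinv hplus hminus hgen

theorem infGen_mem_tangentConstraint (ξ : GroupLieAlgebra 𝓘(ℝ, EG) G) (d : D) :
    infGen G (S.incl d) ξ ∈ S.tangentConstraint d := by
  obtain ⟨r, hΔ, -⟩ := hS.distribution_dim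
  obtain ⟨s, U, t, hs, hUt⟩ := hΔ.exists_isFlowBoxAtlas hinv
  have : Countable s := hs.to_subtype
  have hm := dmap_infGen hminus (S.mdifferentiable_minus (S.incl d)) ξ
  have hp := dmap_infGen hplus (S.mdifferentiable_plus (S.incl d)) ξ
  exact hS.mem_tangentConstraint hUt (hm ▸ hgen ξ _) (hp ▸ hgen ξ _)

variable [FiniteDimensional ℝ EV] [IsManifold 𝓘(ℝ, EV) ∞ V] [LieGroup 𝓘(ℝ, EG) ∞ G]
  [ContMDiffSMul 𝓘(ℝ, EG) 𝓘(ℝ, EQ) ∞ G Q]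

theorem eventually_smul_mem_constraint {v : V} (hv : v ∈ S.constraint) :
    ∀ᶠ g : G in 𝓝 1, g • v ∈ S.constraint := by
  obtain ⟨d, rfl⟩ := hv
  obtain ⟨r, hΔ, -⟩ := hS.distribution_dim
  obtain ⟨s, U, t, hs, hUt⟩ := hΔ.exists_isFlowBoxAtlas hinv
  have : Countable s := hs.to_subtype
  obtain ⟨i, hi⟩ := hUt.exists_mem (S.minus (S.incl d))
  obtain ⟨j, hj⟩ := hUt.exists_mem (S.plus (S.incl d))
  have horbit := (contMDiff_orbit EG G EV (S.incl d)).continuous.tendsto 1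
  rw [one_smul] at horbit
  filter_upwards [horbit.eventually (hS.eventually_mem_constraint hUt hi hj),
    (hUt.isFlowBox i).eventually_smul_eq hgen hi, (hUt.isFlowBox j).eventually_smul_eq hgen hj]
    with g hmem hti htj
  exact hmem (Prod.ext ((congrArg (t i) (hminus g _)).trans hti)
    ((congrArg (t j) (hplus g _)).trans htj))

theorem isSymmetric [ConnectedSpace G] (hclosed : IsClosed S.constraint)
    (hΔ : IsInvariantDistribution G Δ) (hσ : IsInvariantForm G S.σ)
    (hσ₀ : ∀ v ∈ S.constraint, ∀ ξ : GroupLieAlgebra 𝓘(ℝ, EG) G, S.σ v (infGen G v ξ) = 0) :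
    S.IsSymmetric (EG := EG) G where
  plus_smul := hplus
  minus_smul := hminus
  form_invariant := hσ
  constraint_invariant g v hv := by
    have : IsTopologicalGroup G := topologicalGroup_of_lieGroup 𝓘(ℝ, EG) ∞
    exact smul_mem_of_isClosed hclosed
      (fun _ hx => hS.eventually_smul_mem_constraint hinv hplus hminus hgen hx) g hv
      (contMDiff_orbit EG G EV v).continuous
  force_invariant := hS.isInvariantForce hplus hΔ
  form_infGen := hσ₀

end HasLinearConstraints

end DCLS

end MomentumConservation

end DiscreteMechanics

end

theorem mainTheorem9_general
    {EQ : Type*} [NormedAddCommGroup EQ] [NormedSpace ℝ EQ] [FiniteDimensional ℝ EQ]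
    {Q : Type*} [TopologicalSpace Q] [ChartedSpace EQ Q] [IsManifold 𝓘(ℝ, EQ) ∞ Q]
    [SecondCountableTopology Q]
    {EV : Type*} [NormedAddCommGroup EV] [NormedSpace ℝ EV] [FiniteDimensional ℝ EV]
    {V : Type*} [TopologicalSpace V] [ChartedSpace EV V] [IsManifold 𝓘(ℝ, EV) ∞ V]
    {ED : Type*} [NormedAddCommGroup ED] [NormedSpace ℝ ED] [FiniteDimensional ℝ ED]
    {D : Type*} [TopologicalSpace D] [ChartedSpace ED D] [IsManifold 𝓘(ℝ, ED) ∞ D]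
    {EG : Type*} [NormedAddCommGroup EG] [NormedSpace ℝ EG]
    {G : Type*} [TopologicalSpace G] [ChartedSpace EG G] [Group G] [LieGroup 𝓘(ℝ, EG) ∞ G]
    [MulAction G Q] [ContMDiffSMul 𝓘(ℝ, EG) 𝓘(ℝ, EQ) ∞ G Q]
    [MulAction G V] [ContMDiffSMul 𝓘(ℝ, EG) 𝓘(ℝ, EV) ∞ G V]
    (S : DiscreteMechanics.DCLS EQ Q EV V ED D)
    (Δ : ∀ q : Q, Submodule ℝ (TangentSpace 𝓘(ℝ, EQ) q))
    (hS : S.HasLinearConstraints Δ) (hinv : DiscreteMechanics.IsInvolutive Δ)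
    (hplus : ∀ (g : G) (v : V), S.plus (g • v) = g • S.plus v)
    (hminus : ∀ (g : G) (v : V), S.minus (g • v) = g • S.minus v)
    (hΔ : DiscreteMechanics.IsInvariantDistribution G Δ)
    (hgen : ∀ (ξ : GroupLieAlgebra 𝓘(ℝ, EG) G) (q : Q), DiscreteMechanics.infGen G q ξ ∈ Δ q)
    (hσ : DiscreteMechanics.IsInvariantForm G S.σ)
    (hσ₀ : ∀ v ∈ S.constraint, ∀ ξ : GroupLieAlgebra 𝓘(ℝ, EG) G,
      S.σ v (DiscreteMechanics.infGen G v ξ) = 0)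
    (F : V → V) (U W : Set V) (hF : S.IsEvolution F U W) :
    (∀ (ξ : GroupLieAlgebra 𝓘(ℝ, EG) G) (d : D),
      DiscreteMechanics.infGen G (S.incl d) ξ ∈ S.tangentConstraint d) ∧
    (∀ v ∈ S.constraint, ∀ᶠ g : G in 𝓝 1, g • v ∈ S.constraint) ∧
    S.IsInvariantForce G ∧
    (ConnectedSpace G → IsClosed S.constraint → S.IsSymmetric (EG := EG) G) ∧
    S.ConservesMomentum (EG := EG) G F U :=
  ⟨hS.infGen_mem_tangentConstraint hinv hplus hminus hgen,
    fun _ hv => hS.eventually_smul_mem_constraint hinv hplus hminus hgen hv,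
    hS.isInvariantForce hplus hΔ,
    fun _ hclosed => hS.isSymmetric hinv hplus hminus hgen hclosed hΔ hσ hσ₀,
    hF.conservesMomentum hplus hminus (fun d ξ => hS.force_eq d ▸ hgen ξ _) hσ₀⟩

theorem mainTheorem9
    {EQ : Type*} [NormedAddCommGroup EQ] [NormedSpace ℝ EQ] [FiniteDimensional ℝ EQ]
    {Q : Type*} [TopologicalSpace Q] [ChartedSpace EQ Q] [IsManifold 𝓘(ℝ, EQ) ∞ Q]
    [T2Space Q] [SecondCountableTopology Q]
    {EV : Type*} [NormedAddCommGroup EV] [NormedSpace ℝ EV] [FiniteDimensional ℝ EV]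
    {V : Type*} [TopologicalSpace V] [ChartedSpace EV V] [IsManifold 𝓘(ℝ, EV) ∞ V]
    [T2Space V] [SecondCountableTopology V]
    {ED : Type*} [NormedAddCommGroup ED] [NormedSpace ℝ ED] [FiniteDimensional ℝ ED]
    {D : Type*} [TopologicalSpace D] [ChartedSpace ED D] [IsManifold 𝓘(ℝ, ED) ∞ D]
    {EG : Type*} [NormedAddCommGroup EG] [NormedSpace ℝ EG] [FiniteDimensional ℝ EG]
    {G : Type*} [TopologicalSpace G] [ChartedSpace EG G] [Group G] [LieGroup 𝓘(ℝ, EG) ∞ G]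
    [MulAction G Q] [ContMDiffSMul 𝓘(ℝ, EG) 𝓘(ℝ, EQ) ∞ G Q]
    [MulAction G V] [ContMDiffSMul 𝓘(ℝ, EG) 𝓘(ℝ, EV) ∞ G V]
    (S : DiscreteMechanics.DCLS EQ Q EV V ED D)
    (Δ : ∀ q : Q, Submodule ℝ (TangentSpace 𝓘(ℝ, EQ) q))
    (hS : S.IsHolonomic Δ)
    (hplus : ∀ (g : G) (v : V), S.plus (g • v) = g • S.plus v)
    (hminus : ∀ (g : G) (v : V), S.minus (g • v) = g • S.minus v)
    (hΔ : DiscreteMechanics.IsInvariantDistribution G Δ)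
    (hgen : ∀ (ξ : GroupLieAlgebra 𝓘(ℝ, EG) G) (q : Q), DiscreteMechanics.infGen G q ξ ∈ Δ q)
    (hσ : DiscreteMechanics.IsInvariantForm G S.σ)
    (hσ₀ : ∀ v ∈ S.constraint, ∀ ξ : GroupLieAlgebra 𝓘(ℝ, EG) G,
      S.σ v (DiscreteMechanics.infGen G v ξ) = 0)
    (F : V → V) (U W : Set V) (hF : S.IsEvolution F U W) :
    (∀ (ξ : GroupLieAlgebra 𝓘(ℝ, EG) G) (d : D),
      DiscreteMechanics.infGen G (S.incl d) ξ ∈ S.tangentConstraint d) ∧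
    (∀ v ∈ S.constraint, ∀ᶠ g : G in 𝓝 1, g • v ∈ S.constraint) ∧
    S.IsInvariantForce G ∧
    (ConnectedSpace G → IsClosed S.constraint → S.IsSymmetric (EG := EG) G) ∧
    S.ConservesMomentum (EG := EG) G F U :=
  mainTheorem9_general S Δ hS.toHasLinearConstraints hS.involutive hplus hminus hΔ hgen hσ hσ₀
    F U W hF
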